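/- Let $\mathbb{D}=\{z\in\mathbb{C}:|z|<1\}$ and let $\mathcal{A}$ be the class of analytic functions $f$ on $\mathbb{D}$ with $f(0)=0$ and $f'(0)=1$. For real $\alpha,\gamma\ge 0$ and $\beta<1$ let $W_\beta(\alpha,\gamma)$ be the class of all $f\in\mathcal{A}$ for which there is $\phi\in\mathbb{R}$ with $$\mathrm{Re}\left(e^{i\phi}\left((1-\alpha+2\gamma)\frac{f(z)}{z}+(\alpha-2\gamma)f'(z)+\gamma z f''(z)-\beta\right)\right)>0,\qquad z\in\mathbb{D}$$ (with $f(z)/z$ read as $f'(0)$ at $z=0$). For $0\le\xi\le 1$ let $M(\xi)$ be the Pascu class of all $f\in\mathcal{A}$ with $$\mathrm{Re}\,\frac{\xi z(zf'(z))'+(1-\xi)zf'(z)}{\xi zf'(z)+(1-\xi)f(z)}>0,\qquad z\in\mathbb{D}$$ (the quotient being read as its limit $1$ at $z=0$, and the denominator having no other zero in $\mathbb{D}$). Let $0\le\xi\le 1$, $\mu>1$, $\nu>1$, and let $\alpha,\gamma$ be determined by $\mu+\nu=\alpha-\gamma$, $\mu\nu=\gamma$. For $0\le t<1$ put $$g(t)=2\sum_{n=0}^\infty\frac{(n+1)(-1)^n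 t^n}{(1+\mu n)(1+\nu n)}-1,\qquad q(t)=\sum_{n=0}^\infty\frac{(n+1)^2(-1)^n t^n}{(1+\mu n)(1+\nu n)}.$$ Let $c$ be a real number with $$-1<c\le\min\left(1+\frac1\mu-\frac1\nu,\ \frac{1+\frac1\mu-\xi}{1+2\xi}\right),$$ put $\lambda(t)=(c+1)t^c$, and let $\rho<1$ and $\beta<1$ satisfy $$\frac{1}{2(1-\beta)(1-\rho)}=(c+1)\int_0^1 t^c\left[(1-\xi)\,\frac{1-g(t)}{2}+\xi\,(1-q(t))\right]dt.$$ For $f\in\mathcal{A}$ define $$\mathcal{V}_\lambda(f)(z)=\left(z\int_0^1\lambda(t)\,\frac{1-\rho tz}{1-tz}\,dt\right)*f(z),$$ where $*$ is the Hadamard product, $\left(\sum_k a_kz^k\right)*\left(\sum_k b_kz^k\right)=\sum_k a_kb_kz^k$. Then $\mathcal{V}_\lambda(f)\in M(\xi)$ for every $f\in W_\beta(\alpha,\gamma)$. -/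

import Mathlib

noncomputable section

namespace PascuClass

/-- The class `𝒜` of functions analytic in the open unit disc with `f 0 = 0` and `f' 0 = 1`. -/
def classA : Set (ℂ → ℂ) :=
  {f | DifferentiableOn ℂ f (Metric.ball 0 1) ∧ f 0 = 0 ∧ deriv f 0 = 1}

/-- The class `W_β(α, γ)`.  As `f 0 = 0` on `classA`, `dslope f 0 z` is `f z / z` for `z ≠ 0` and
`f' 0` for `z = 0`, that is, the analytic function `f(z) / z` on the whole disc. -/
def classW (β α γ : ℝ) : Set (ℂ → ℂ) :=
  {f | f ∈ classA ∧ ∃ φ : ℝ, ∀ z ∈ Metric.ball (0 : ℂ) 1,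
    0 < (Complex.exp (φ * Complex.I) *
      ((1 - α + 2 * γ) * dslope f 0 z + (α - 2 * γ) * deriv f z
        + γ * z * deriv (deriv f) z - β)).re}

/-- The Pascu class `M(ξ)`.  At `z = 0` the quotient has the removable value `1`, so only `z ≠ 0`
is tested.  Where the denominator vanishes the quotient is `0` by convention, so the strict
inequality also says that the denominator has no zero other than the origin. -/
def classM (ξ : ℝ) : Set (ℂ → ℂ) :=
  {f | f ∈ classA ∧ ∀ z ∈ Metric.ball (0 : ℂ) 1, z ≠ 0 →
    0 < ((ξ * (z * deriv (fun w => w * deriv f w) z) + (1 - ξ) * (z * deriv f z)) /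
      (ξ * (z * deriv f z) + (1 - ξ) * f z)).re}

/-- The `k`-th Taylor coefficient of `f` at the origin. -/
def taylorCoeff (f : ℂ → ℂ) (k : ℕ) : ℂ := iteratedDeriv k f 0 / (k.factorial : ℂ)

/-- The Hadamard product (convolution) `∑ aₖ bₖ zᵏ` of `f = ∑ aₖ zᵏ` and `g = ∑ bₖ zᵏ`. -/
def hadamard (f g : ℂ → ℂ) (z : ℂ) : ℂ :=
  ∑' k : ℕ, taylorCoeff f k * taylorCoeff g k * z ^ k

/-- The kernel `z ∫₀¹ lam(t) (1 - ρ t z) / (1 - t z) dt`. -/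
def operatorKernel (lam : ℝ → ℝ) (ρ : ℝ) (z : ℂ) : ℂ :=
  z * ∫ t in (0 : ℝ)..1, (lam t : ℂ) * ((1 - ρ * t * z) / (1 - t * z))

/-- The generalized integral operator: convolution with `operatorKernel lam ρ`. -/
def generalizedOperator (lam : ℝ → ℝ) (ρ : ℝ) (f : ℂ → ℂ) : ℂ → ℂ :=
  hadamard (operatorKernel lam ρ) f

/-- The Bernardi weight `(c + 1) t ^ c`. -/
def bernardiWeight (c t : ℝ) : ℝ := (c + 1) * t ^ c

/-- `g(t) = 2 ∑ (n+1) (-1)ⁿ tⁿ / ((1 + μ n)(1 + ν n)) - 1`, for `0 ≤ t < 1`. -/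
def gAux (μ ν t : ℝ) : ℝ :=
  2 * (∑' n : ℕ, ((n : ℝ) + 1) * (-1) ^ n * t ^ n / ((1 + μ * n) * (1 + ν * n))) - 1

/-- `q(t) = ∑ (n+1)² (-1)ⁿ tⁿ / ((1 + μ n)(1 + ν n))`, for `0 ≤ t < 1`. -/
def qAux (μ ν t : ℝ) : ℝ :=
  ∑' n : ℕ, ((n : ℝ) + 1) ^ 2 * (-1) ^ n * t ^ n / ((1 + μ * n) * (1 + ν * n))

end PascuClass

end

/-! Let `V` be the image of `f`, and let N and D be the numerator and denominator of the Pascu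
quotient. Since u ↦ 1/(1 - u) sends Re u ≤ 0 into the disc |w - 1/2| ≤ 1/2, it suffices that D + w(N
- D) ≠ 0 for z ≠ 0 and every such w (`re_div_pos_of_forall_ne_zero`). Comparing coefficients, (D +
w(N - D))/z is, up to a nonzero constant, the Hadamard product of the function whose real part is
positive by the definition of W with a kernel K. Here K(0) = 1, and for n ≥ 1 the coefficients of K
are M(1 + ξn)(1 + nw)/((n + a)(n + m)(n + v)), where a = c + 1, m = 1/μ, v = 1/ν. If Re K ≥ 1/2,
then 2 Re K - 1 is a nonnegative weight of mean 1 on circles, so the product keeps a positive real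
part and cannot vanish (`re_convolution_pos`).

The factor (1 + ξn)/((n + a)(n + m)(n + v)) is the n-th moment of `density` on (0, 1), while Σ (1 +
nw) ζⁿ = (1 + (w - 1)ζ)/(1 - ζ)². The relation between β and ρ fixes the integral of `density`
against 1/(1 + t)². Hence Re K ≥ 1/2 says that the integral of `density` against Re (1 + (w -
1)tz)/(1 - tz)² is at least that against 1/(1 + t)².

This extremal inequality holds for every integrable weight φ ≥ 0 with φ(t)/(1 - t) decreasing
(`integral_mul_re_kernel_nonneg`). A lower bound for the difference of the two kernels changes sign
at most once, from + to -, so φ may be replaced by one explicit reference weight; there an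
approximate primitive settles the matter (`integral_refWeight_mul_lowerKernel_nonneg`). That
`density` is such a weight rests on a + v ≤ 3, which follows from c ≤ 1 + 1/μ - 1/ν and 1/μ ≤ 1
(`antitoneOn_density_div`). -/

open Set MeasureTheory Filter Topology

/-! ### Power series on the unit disc -/

namespace PascuClass

/-- `F` is the sum of the power series `∑ aₙ zⁿ` on the open unit disc. -/
def HasDiscSeries (a : ℕ → ℂ) (F : ℂ → ℂ) : Prop :=
  ∀ z ∈ Metric.ball (0 : ℂ) 1, HasSum (fun n => a n * z ^ n) (F z)

namespace HasDiscSeries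

variable {a : ℕ → ℂ} {F : ℂ → ℂ}

theorem of_differentiableOn (hF : DifferentiableOn ℂ F (Metric.ball 0 1)) :
    HasDiscSeries (taylorCoeff F) F := by
  intro z hz
  have h := Complex.hasSum_taylorSeries_on_ball (r := 1) (c := 0) (f := F) (by simpa using hF)
    (by simpa using hz)
  refine h.congr_fun fun n => ?_
  simp only [taylorCoeff, sub_zero, smul_eq_mul]
  ring

theorem summable_norm (h : HasDiscSeries a F) {r : ℝ} (hr : 0 ≤ r) (hr1 : r < 1) :
    Summable fun n => ‖a n‖ * r ^ n := by
  have := (h (r : ℂ) (by simpa [abs_of_nonneg hr] using hr1)).summable.norm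
  simpa [abs_of_nonneg hr] using this

theorem hasFPowerSeriesOnBall (h : HasDiscSeries a F) :
    HasFPowerSeriesOnBall F (FormalMultilinearSeries.ofScalars ℂ a) 0 1 := by
  refine ⟨?_, one_pos, ?_⟩
  · refine ENNReal.le_of_forall_nnreal_lt fun r hr => ?_
    refine FormalMultilinearSeries.le_radius_of_summable_norm _ ?_
    have hr' : (r : ℝ) < 1 := by exact_mod_cast hr
    simpa [FormalMultilinearSeries.ofScalars_norm] using h.summable_norm r.2 hr'
  · intro y hy
    have hy' : y ∈ Metric.ball (0 : ℂ) 1 := by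
      rw [← Metric.eball_ofReal]
      simpa using hy
    simpa [FormalMultilinearSeries.ofScalars_apply_eq, zero_add, mul_comm] using h y hy'

theorem differentiableOn (h : HasDiscSeries a F) :
    DifferentiableOn ℂ F (Metric.ball 0 1) := by
  have := h.hasFPowerSeriesOnBall.differentiableOn
  rwa [← ENNReal.ofReal_one, Metric.eball_ofReal] at this

theorem taylorCoeff_eq (h : HasDiscSeries a F) (n : ℕ) : taylorCoeff F n = a n := by
  have h1 := h.hasFPowerSeriesOnBall.hasFPowerSeriesAt
  have h2 := (of_differentiableOn h.differentiableOn).hasFPowerSeriesOnBall.hasFPowerSeriesAt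
  have := h2.eq_formalMultilinearSeries h1
  exact congrFun (FormalMultilinearSeries.ofScalars_series_injective ℂ ℂ this) n

theorem congr (h : HasDiscSeries a F) {b : ℕ → ℂ} {G : ℂ → ℂ} (hab : ∀ n, a n = b n)
    (hFG : ∀ z ∈ Metric.ball (0 : ℂ) 1, F z = G z) : HasDiscSeries b G := by
  intro z hz
  rw [← hFG z hz, ← funext hab]
  exact h z hz

theorem deriv (h : HasDiscSeries a F) :
    HasDiscSeries (fun n => (n + 1) * a (n + 1)) (deriv F) := by
  have hd : DifferentiableOn ℂ (_root_.deriv F) (Metric.ball 0 1) :=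
    h.differentiableOn.deriv Metric.isOpen_ball
  refine (of_differentiableOn hd).congr (fun n => ?_) (fun _ _ => rfl)
  rw [← h.taylorCoeff_eq (n + 1)]
  simp only [taylorCoeff, iteratedDeriv_succ', Nat.factorial_succ]
  have : (n.factorial : ℂ) ≠ 0 := by exact_mod_cast n.factorial_ne_zero
  have : (n : ℂ) + 1 ≠ 0 := by exact_mod_cast n.succ_ne_zero
  push_cast
  field_simp

theorem id_mul (h : HasDiscSeries a F) :
    HasDiscSeries (fun n => Nat.casesOn n 0 a) (fun z => z * F z) := by
  intro z hz
  rw [← hasSum_nat_add_iff' 1]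
  have hz' : z * F z - ∑ i ∈ Finset.range 1, (Nat.casesOn i 0 a : ℂ) * z ^ i = z * F z := by
    simp
  rw [hz']
  refine ((h z hz).mul_left z).congr_fun fun n => ?_
  simp only [pow_succ]
  ring

theorem id_mul_deriv (h : HasDiscSeries a F) :
    HasDiscSeries (fun n => n * a n) (fun z => z * _root_.deriv F z) := by
  refine h.deriv.id_mul.congr (fun n => ?_) (fun _ _ => rfl)
  cases n <;> simp

theorem add (h : HasDiscSeries a F) {b : ℕ → ℂ} {G : ℂ → ℂ} (hG : HasDiscSeries b G) :
    HasDiscSeries (fun n => a n + b n) (fun z => F z + G z) := by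
  intro z hz
  simpa only [add_mul] using (h z hz).add (hG z hz)

theorem const_mul (h : HasDiscSeries a F) (k : ℂ) :
    HasDiscSeries (fun n => k * a n) (fun z => k * F z) := by
  intro z hz
  simpa only [mul_assoc] using (h z hz).mul_left k

theorem dslope_zero (h : HasDiscSeries a F) (h0 : F 0 = 0) :
    HasDiscSeries (fun n => a (n + 1)) (dslope F 0) := by
  have ha0 : a 0 = 0 := by
    rw [← h.taylorCoeff_eq 0]; simp [taylorCoeff, h0]
  intro z hz
  by_cases hz0 : z = 0
  · subst hz0
    rw [dslope_same]
    have h1 := (h.deriv 0 hz).unique (hasSum_single 0 (by intro n hn; simp [hn]))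
    have h2 : HasSum (fun n => a (n + 1) * (0 : ℂ) ^ n) _ :=
      hasSum_single 0 (by intro n hn; simp [hn])
    simpa [h1] using h2
  · rw [dslope_of_ne _ hz0, slope_def_field, h0, sub_zero, sub_zero, div_eq_mul_inv]
    have := h z hz
    rw [← hasSum_nat_add_iff' 1] at this
    simp only [Finset.range_one, Finset.sum_singleton, ha0, zero_mul, sub_zero] at this
    refine (this.mul_right z⁻¹).congr_fun fun n => ?_
    rw [pow_succ]; field_simp

theorem of_summable (ha : ∀ z ∈ Metric.ball (0 : ℂ) 1, Summable fun n => a n * z ^ n) :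
    HasDiscSeries a (fun z => ∑' n, a n * z ^ n) :=
  fun z hz => (ha z hz).hasSum

end HasDiscSeries

/-! ### Fourier coefficients on circles and Hadamard products -/

theorem hasSum_intervalIntegral_of_norm_le {f : ℕ → ℝ → ℂ} {g : ℝ → ℂ} {u : ℕ → ℝ} {a b : ℝ}
    (hf : ∀ n, Continuous (f n)) (hu : Summable u) (hfu : ∀ n θ, ‖f n θ‖ ≤ u n)
    (hg : ∀ θ, HasSum (fun n => f n θ) (g θ)) :
    HasSum (fun n => ∫ θ in a..b, f n θ) (∫ θ in a..b, g θ) :=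
  intervalIntegral.hasSum_integral_of_dominated_convergence (fun n _ => u n)
    (fun n => (hf n).aestronglyMeasurable)
    (fun n => ae_of_all _ fun θ _ => hfu n θ) (ae_of_all _ fun _ _ => hu)
    intervalIntegrable_const (ae_of_all _ fun θ _ => hg θ)

theorem integral_exp_int_mul_I (j : ℤ) :
    ∫ θ in (0 : ℝ)..2 * Real.pi, Complex.exp (j * θ * Complex.I) =
      if j = 0 then 2 * Real.pi else 0 := by
  split_ifs with hj
  · simp [hj]
  · have hc : (j * Complex.I : ℂ) ≠ 0 := by simp [hj]
    have h := integral_exp_mul_complex (a := 0) (b := 2 * Real.pi) hc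
    have h2 : (j * Complex.I * ((2 * Real.pi : ℝ) : ℂ)) = j * (2 * Real.pi * Complex.I) := by
      push_cast; ring
    rw [h2, Complex.exp_int_mul_two_pi_mul_I] at h
    simp only [Complex.ofReal_zero, mul_zero, Complex.exp_zero, sub_self, zero_div] at h
    rw [Complex.ofReal_zero, ← h]
    congr 1
    ext θ
    ring_nf

variable {k : ℕ → ℂ} {K : ℂ → ℂ}

theorem mul_exp_mem_ball {z : ℂ} (hz : z ∈ Metric.ball (0 : ℂ) 1) (θ : ℝ) :
    z * Complex.exp (θ * Complex.I) ∈ Metric.ball (0 : ℂ) 1 := by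
  simpa [Complex.norm_exp_ofReal_mul_I] using hz

namespace HasDiscSeries

theorem integral_exp_mul (hK : HasDiscSeries k K) {r : ℝ} (hr : 0 ≤ r) (hr1 : r < 1) (n : ℕ) :
    ∫ θ in (0 : ℝ)..2 * Real.pi, Complex.exp (-(n * θ * Complex.I)) *
      K (r * Complex.exp (θ * Complex.I)) = 2 * Real.pi * (k n * r ^ n) := by
  have hrb : (r : ℂ) ∈ Metric.ball (0 : ℂ) 1 := by simpa [abs_of_nonneg hr] using hr1
  have h := hasSum_intervalIntegral_of_norm_le (a := 0) (b := 2 * Real.pi)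
    (f := fun m θ => k m * r ^ m * Complex.exp (((m - n : ℤ) : ℂ) * θ * Complex.I))
    (g := fun θ => Complex.exp (-(n * θ * Complex.I)) * K (r * Complex.exp (θ * Complex.I)))
    (fun m => by fun_prop) (hK.summable_norm hr hr1)
    (fun m θ => by
      rw [norm_mul, ← Complex.ofReal_intCast, ← Complex.ofReal_mul,
        Complex.norm_exp_ofReal_mul_I]
      simp [abs_of_nonneg hr])
    (fun θ => by
      refine ((hK _ (mul_exp_mem_ball hrb θ)).mul_left _).congr_fun fun m => ?_
      rw [mul_pow, ← Complex.exp_nat_mul]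
      have : Complex.exp (((m - n : ℤ) : ℂ) * θ * Complex.I) =
          Complex.exp (-(n * θ * Complex.I)) * Complex.exp (m * (θ * Complex.I)) := by
        rw [← Complex.exp_add]; congr 1; push_cast; ring
      rw [this]; ring)
  simp only [intervalIntegral.integral_const_mul, integral_exp_int_mul_I] at h
  rw [h.unique (hasSum_single n ?_)]
  · simp; ring
  · intro m hm
    simp [sub_eq_zero, hm]

/-- The conjugate of `K` on a circle carries only nonpositive frequencies, so it contributes only at
n = 0. -/
theorem integral_exp_mul_conj (hK : HasDiscSeries k K) {r : ℝ} (hr : 0 ≤ r) (hr1 : r < 1)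
    (n : ℕ) :
    ∫ θ in (0 : ℝ)..2 * Real.pi, Complex.exp (-(n * θ * Complex.I)) *
      (starRingEnd ℂ) (K (r * Complex.exp (θ * Complex.I))) =
        if n = 0 then 2 * Real.pi * (starRingEnd ℂ) (k 0) else 0 := by
  have hrb : (r : ℂ) ∈ Metric.ball (0 : ℂ) 1 := by simpa [abs_of_nonneg hr] using hr1
  have h := hasSum_intervalIntegral_of_norm_le (a := 0) (b := 2 * Real.pi)
    (f := fun m θ => (starRingEnd ℂ) (k m) * r ^ m *
      Complex.exp (((-(m + n) : ℤ) : ℂ) * θ * Complex.I))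
    (g := fun θ => Complex.exp (-(n * θ * Complex.I)) *
      (starRingEnd ℂ) (K (r * Complex.exp (θ * Complex.I))))
    (fun m => by fun_prop) (hK.summable_norm hr hr1)
    (fun m θ => by
      rw [norm_mul, ← Complex.ofReal_intCast, ← Complex.ofReal_mul,
        Complex.norm_exp_ofReal_mul_I]
      simp [abs_of_nonneg hr])
    (fun θ => by
      refine (((Complex.hasSum_conj.2 (by simpa using hK _ (mul_exp_mem_ball hrb θ)))).mul_left
        _).congr_fun fun m => ?_
      rw [map_mul, map_pow, map_mul, mul_pow, ← Complex.exp_conj, ← Complex.exp_nat_mul]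
      have : Complex.exp (((-(m + n) : ℤ) : ℂ) * θ * Complex.I) =
          Complex.exp (-(n * θ * Complex.I)) *
            Complex.exp (m * (starRingEnd ℂ) (θ * Complex.I)) := by
        rw [← Complex.exp_add]; congr 1; simp; ring
      rw [this]; simp; ring)
  simp only [intervalIntegral.integral_const_mul, integral_exp_int_mul_I] at h
  rw [h.unique (hasSum_single 0 ?_)]
  · by_cases hn : n = 0
    · simp [hn]; ring
    · simp [hn]
  · intro m hm
    have : ¬ (-(m + n) : ℤ) = 0 := by omega
    simp only [this, if_false, Complex.ofReal_zero, mul_zero]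

theorem continuous_circle (hK : HasDiscSeries k K) {z : ℂ} (hz : z ∈ Metric.ball (0 : ℂ) 1) :
    Continuous fun θ : ℝ => K (z * Complex.exp (θ * Complex.I)) :=
  hK.differentiableOn.continuousOn.comp_continuous (by fun_prop) (mul_exp_mem_ball hz)

/-- If `Re K ≥ 1/2` and `K 0 = 1`, then the Hadamard product with `K` maps a function with positive
real part to a function with positive real part. -/
theorem re_convolution_pos {q : ℕ → ℂ} {Q : ℂ → ℂ} (hQ : HasDiscSeries q Q)
    (hK : HasDiscSeries k K) (hk0 : k 0 = 1)
    (hQpos : ∀ z ∈ Metric.ball (0 : ℂ) 1, 0 < (Q z).re)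
    (hKre : ∀ z ∈ Metric.ball (0 : ℂ) 1, 1 / 2 ≤ (K z).re)
    {z s : ℂ} (hz : z ∈ Metric.ball (0 : ℂ) 1) (hs : HasSum (fun n => q n * k n * z ^ n) s) :
    0 < s.re := by
  -- Splitting z = r · (z/r) keeps both factors inside the disc: `K` is sampled on the circle of
  -- radius r and `Q` on that of radius |z|/r.
  obtain ⟨r, hzr, hr1⟩ := exists_between (show ‖z‖ < 1 by simpa using hz)
  have hr0 : 0 < r := (norm_nonneg z).trans_lt hzr
  have hrb : (r : ℂ) ∈ Metric.ball (0 : ℂ) 1 := by simpa [abs_of_pos hr0] using hr1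
  have hx : ‖z / r‖ < 1 := by
    rw [norm_div, Complex.norm_real, Real.norm_of_nonneg hr0.le, div_lt_one hr0]
    exact hzr
  have hxb : z / r ∈ Metric.ball (0 : ℂ) 1 := by simpa using hx
  set W : ℝ → ℝ := fun θ => 2 * (K (r * Complex.exp (θ * Complex.I))).re - 1 with hW
  have hWc : Continuous W := by
    have := Complex.continuous_re.comp (hK.continuous_circle hrb)
    exact (continuous_const.mul this).sub continuous_const
  have hW0 : ∀ θ, 0 ≤ W θ := fun θ => by
    have := hKre _ (mul_exp_mem_ball hrb θ)
    simp only [hW]; linarith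
  have hWC : ∀ θ, (W θ : ℂ) = K (r * Complex.exp (θ * Complex.I)) +
      (starRingEnd ℂ) (K (r * Complex.exp (θ * Complex.I))) - 1 := fun θ => by
    rw [Complex.add_conj]; simp [hW]
  have hint : ∀ n : ℕ, ∫ θ in (0 : ℝ)..2 * Real.pi, Complex.exp (-(n * θ * Complex.I)) * W θ =
      2 * Real.pi * (k n * r ^ n) := by
    intro n
    have c1 := hK.continuous_circle hrb
    have c2 : Continuous fun θ : ℝ => Complex.exp (-(n * θ * Complex.I)) := by fun_prop
    have c3 : Continuous fun θ : ℝ => (starRingEnd ℂ) (K (r * Complex.exp (θ * Complex.I))) :=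
      Complex.continuous_conj.comp c1
    have e : ∀ θ : ℝ, Complex.exp (-(n * θ * Complex.I)) * W θ =
        Complex.exp (-(n * θ * Complex.I)) * K (r * Complex.exp (θ * Complex.I)) +
        Complex.exp (-(n * θ * Complex.I)) *
          (starRingEnd ℂ) (K (r * Complex.exp (θ * Complex.I))) -
        Complex.exp (((-n : ℤ) : ℂ) * θ * Complex.I) := fun θ => by
      rw [hWC]; push_cast; ring_nf
    simp_rw [e]
    rw [intervalIntegral.integral_sub, intervalIntegral.integral_add,
      hK.integral_exp_mul hr0.le hr1, hK.integral_exp_mul_conj hr0.le hr1, integral_exp_int_mul_I]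
    -- At n = 0 the three terms give k₀ + conj k₀ - 1 = 1 = k₀.
    · by_cases hn : n = 0
      · simp [hn, hk0]
      · simp [hn]
    · exact (c2.mul c1).intervalIntegrable _ _
    · exact (c2.mul c3).intervalIntegrable _ _
    · exact ((c2.mul c1).add (c2.mul c3)).intervalIntegrable _ _
    · exact Continuous.intervalIntegrable (by fun_prop) _ _
  obtain ⟨M, hM⟩ := (isCompact_Icc (a := 0) (b := 2 * Real.pi)).exists_bound_of_continuousOn
    hWc.continuousOn
  have hQc : Continuous fun θ : ℝ => Q (z / r * Complex.exp (-(θ * Complex.I))) := by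
    have := (hQ.continuous_circle hxb).comp (continuous_neg (G := ℝ))
    refine this.congr fun θ => ?_
    simp
  have hmem : ∀ θ : ℝ, z / r * Complex.exp (-(θ * Complex.I)) ∈ Metric.ball (0 : ℂ) 1 :=
    fun θ => by simpa using mul_exp_mem_ball hxb (-θ)
  have hsum : HasSum (fun n : ℕ => 2 * Real.pi * (q n * k n * z ^ n))
      (∫ θ in (0 : ℝ)..2 * Real.pi, Q (z / r * Complex.exp (-(θ * Complex.I))) * W θ) := by
    have h := intervalIntegral.hasSum_integral_of_dominated_convergence
      (a := 0) (b := 2 * Real.pi) (μ := volume)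
      (F := fun n θ => q n * (z / r) ^ n * (Complex.exp (-(n * θ * Complex.I)) * W θ))
      (f := fun θ => Q (z / r * Complex.exp (-(θ * Complex.I))) * W θ)
      (fun n _ => ‖q n‖ * ‖z / r‖ ^ n * M)
      (fun n => by
        have : Continuous fun θ : ℝ => (W θ : ℂ) := Complex.continuous_ofReal.comp hWc
        exact Continuous.aestronglyMeasurable (by fun_prop))
      (fun n => ae_of_all _ fun θ hθ => by
        rw [uIoc_of_le (by positivity)] at hθ
        have h1 := hM θ ⟨hθ.1.le, hθ.2⟩
        have h2 : ‖Complex.exp (-(n * θ * Complex.I))‖ = 1 := by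
          have := Complex.norm_exp_ofReal_mul_I (-(n * θ))
          rw [← this]; congr 2; push_cast; ring
        rw [norm_mul, norm_mul, norm_mul, h2, norm_pow, one_mul, Complex.norm_real]
        gcongr)
      (ae_of_all _ fun _ _ => (hQ.summable_norm (norm_nonneg _) hx).mul_right M)
      intervalIntegrable_const
      (ae_of_all _ fun θ _ => by
        refine ((hQ _ (hmem θ)).mul_right _).congr_fun fun n => ?_
        rw [mul_pow, ← Complex.exp_nat_mul]
        ring_nf)
    refine h.congr_fun fun n => ?_
    rw [intervalIntegral.integral_const_mul, hint, div_pow]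
    have : (r : ℂ) ^ n ≠ 0 := pow_ne_zero _ (by exact_mod_cast hr0.ne')
    field_simp
  have hval := (hs.mul_left (2 * Real.pi : ℂ)).unique hsum
  have hQW : Continuous fun θ : ℝ => Q (z / r * Complex.exp (-(θ * Complex.I))) * W θ :=
    hQc.mul (Complex.continuous_ofReal.comp hWc)
  -- A minimum attained on the compact circle gives a bound δ > 0, which makes the final inequality
  -- strict.
  obtain ⟨θ₀, -, hθ₀⟩ := (isCompact_Icc (a := 0) (b := 2 * Real.pi)).exists_isMinOn
    (nonempty_Icc.2 (by positivity)) (Complex.continuous_re.comp hQc).continuousOn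
  set δ := (Q (z / r * Complex.exp (-(θ₀ * Complex.I)))).re with hδ
  have hδ0 : 0 < δ := hQpos _ (hmem θ₀)
  have hWint : ∫ θ in (0 : ℝ)..2 * Real.pi, W θ = 2 * Real.pi := by
    have := hint 0
    simp only [CharP.cast_eq_zero, zero_mul, neg_zero, Complex.exp_zero, one_mul, hk0, pow_zero,
      mul_one] at this
    rw [intervalIntegral.integral_ofReal] at this
    exact_mod_cast this
  have hre : (∫ θ in (0 : ℝ)..2 * Real.pi, Q (z / r * Complex.exp (-(θ * Complex.I))) * W θ).re =
      ∫ θ in (0 : ℝ)..2 * Real.pi, (Q (z / r * Complex.exp (-(θ * Complex.I)))).re * W θ := by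
    have := Complex.reCLM.intervalIntegral_comp_comm
      (hQW.intervalIntegrable (μ := volume) 0 (2 * Real.pi))
    simp only [Complex.reCLM_apply] at this
    rw [← this]
    simp only [Complex.re_mul_ofReal]
  have hge : δ * (2 * Real.pi) ≤
      ∫ θ in (0 : ℝ)..2 * Real.pi, (Q (z / r * Complex.exp (-(θ * Complex.I)))).re * W θ := by
    have h1 : δ * (2 * Real.pi) = ∫ θ in (0 : ℝ)..2 * Real.pi, δ * W θ := by
      rw [intervalIntegral.integral_const_mul, hWint]
    rw [h1]
    refine intervalIntegral.integral_mono_on (μ := volume) (by positivity)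
      ((continuous_const.mul hWc).intervalIntegrable _ _)
      (((Complex.continuous_re.comp hQc).mul hWc).intervalIntegrable _ _) fun θ hθ => ?_
    exact mul_le_mul_of_nonneg_right (hθ₀ hθ) (hW0 θ)
  rw [← hre, ← hval] at hge
  have h2 : ((2 * Real.pi : ℂ) * s).re = 2 * Real.pi * s.re := by
    have : (2 * Real.pi : ℂ) = ((2 * Real.pi : ℝ) : ℂ) := by push_cast; rfl
    rw [this, Complex.re_ofReal_mul]
  rw [h2] at hge
  have hpi := Real.pi_pos
  nlinarith

end HasDiscSeries

/-! ### The lower kernel and the reference weight -/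

/-- The Möbius coordinate `(1 - s) / (1 + s)`. -/
noncomputable def cayley (s : ℝ) : ℝ := (1 - s) / (1 + s)

/-- `|1 - ζ|² / (1 + |ζ|)²` in terms of `q = cayley |ζ|` and `Y = (1 + cos (arg ζ)) / 2`. -/
def modSq (Y q : ℝ) : ℝ := 1 - Y * (1 - q ^ 2)

/-- The factor of the kernel that carries its sign. -/
def signFactor (Y q : ℝ) : ℝ := q ^ 2 - modSq Y q * (1 - 2 * q - q ^ 2)

/-- A lower bound of `Re ((1 + (w - 1) ζ) / (1 - ζ)²) - 1 / (1 + |ζ|)²` over `|w - 1/2| ≤ 1/2`. -/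
noncomputable def lowerKernel (Y q : ℝ) : ℝ :=
  Y / 4 * (1 - q ^ 2) * signFactor Y q / modSq Y q ^ 2

/-- A polynomial version of `(1 + q)⁻²`. -/
noncomputable def weightPoly (q : ℝ) : ℝ := 1 - 2 * q + 2 * q ^ 2 - 4 / 5 * q ^ 3

/-- The reference weight. -/
noncomputable def refWeight (q : ℝ) : ℝ := q * (1 + q) * weightPoly q

/-- The primitive of `q (1 - q) weightPoly q (2 q² + 2 q - 1)`. -/
noncomputable def primitivePoly (q : ℝ) : ℝ :=
  -1 / 2 * q ^ 2 + 5 / 3 * q ^ 3 - 2 * q ^ 4 + 24 / 25 * q ^ 5 + 4 / 15 * q ^ 6 - 4 / 7 * q ^ 7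
    + 1 / 5 * q ^ 8

theorem cayley_pos {s : ℝ} (hs : 0 ≤ s) (hs1 : s < 1) : 0 < cayley s :=
  div_pos (by linarith) (by linarith)

theorem cayley_le_one {s : ℝ} (hs : 0 ≤ s) : cayley s ≤ 1 := by
  rw [cayley, div_le_one (by linarith)]; linarith

theorem cayley_anti {s t : ℝ} (hs : 0 ≤ s) (hst : s ≤ t) : cayley t ≤ cayley s := by
  rw [cayley, cayley, div_le_div_iff₀ (by linarith) (by linarith)]; nlinarith

theorem weightPoly_pos {q : ℝ} (hq1 : q ≤ 1) : 0 < weightPoly q := by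
  unfold weightPoly
  nlinarith [mul_nonneg (sub_nonneg.2 hq1) (sq_nonneg (q - 3 / 4)), sq_nonneg (1 - q)]

theorem modSq_pos {Y q : ℝ} (hY : Y ≤ 1) (hq : 0 < q) (hq1 : q ≤ 1) : 0 < modSq Y q := by
  unfold modSq
  nlinarith [mul_nonneg (sub_nonneg.2 hY) (show 0 ≤ 1 - q ^ 2 by nlinarith), pow_pos hq 2]

/-- The sign factor is a convex combination, with weights 1 - Y and Y, of two polynomials increasing
in q ≥ 0. -/
theorem signFactor_mono {Y p q : ℝ} (hY0 : 0 ≤ Y) (hY : Y ≤ 1) (hp : 0 ≤ p) (hpq : p ≤ q) :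
    signFactor Y p ≤ signFactor Y q := by
  have e : ∀ x, signFactor Y x = (1 - Y) * (2 * x ^ 2 + 2 * x - 1) + Y * (2 * x ^ 3 + x ^ 4) :=
    fun x => by unfold signFactor modSq; ring
  rw [e, e]
  have : 0 ≤ 1 - Y := by linarith
  gcongr

/-- With q = `cayley (r * t)` one has 1 - rt = 2q/(1 + q), so `refWeight q` is (1 - rt)/2 times this
function. Its monotonicity is what makes φ/`refWeight` decrease in t. -/
theorem antitoneOn_sq_mul_weightPoly :
    AntitoneOn (fun q : ℝ => (1 + q) ^ 2 * weightPoly q) (Icc 0 1) := by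
  have e : (fun q : ℝ => (1 + q) ^ 2 * weightPoly q) =
      fun q => 1 - q ^ 2 + 6 / 5 * q ^ 3 + 2 / 5 * q ^ 4 - 4 / 5 * q ^ 5 := by
    ext q; unfold weightPoly; ring
  rw [e]
  refine antitoneOn_of_hasDerivWithinAt_nonpos (convex_Icc 0 1) (by fun_prop)
    (f' := fun q => q * (-2 + 18 / 5 * q + 8 / 5 * q ^ 2 - 4 * q ^ 3)) (fun q hq => ?_)
    (fun q hq => ?_)
  · have h1 := (((((hasDerivAt_pow 2 q).const_sub 1).add
      ((hasDerivAt_pow 3 q).const_mul (6 / 5))).add ((hasDerivAt_pow 4 q).const_mul (2 / 5))).sub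
      ((hasDerivAt_pow 5 q).const_mul (4 / 5)))
    refine (h1.congr_deriv ?_).hasDerivWithinAt
    push_cast; ring
  · rw [interior_Icc] at hq
    refine mul_nonpos_of_nonneg_of_nonpos hq.1.le ?_
    nlinarith [mul_nonneg hq.1.le (sq_nonneg (q - 7 / 10)), sq_nonneg (q - 139 / 200)]

theorem primitivePoly_one_nonneg : 0 ≤ primitivePoly 1 := by
  unfold primitivePoly; norm_num

theorem primitivePoly_nonpos {q : ℝ} (hq : 0 ≤ q) (h : 2 * q ^ 2 + 2 * q ≤ 1) :
    primitivePoly q ≤ 0 := by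
  -- The positive root of 2q² + 2q = 1 is (√3 - 1)/2, just below 0.37.
  have hq' : q ≤ 37 / 100 := by nlinarith
  have h3 : q ^ 3 ≤ (37 / 100) ^ 3 := by gcongr
  have h4 : q ^ 4 ≤ q ^ 3 := pow_le_pow_of_le_one hq (by linarith) (by norm_num)
  have h6 : q ^ 6 ≤ q ^ 3 := pow_le_pow_of_le_one hq (by linarith) (by norm_num)
  have h5 : 0 ≤ q ^ 5 := by positivity
  have e : primitivePoly q = q ^ 2 * (-1 / 2 + 5 / 3 * q - 2 * q ^ 2 + 24 / 25 * q ^ 3 +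
    4 / 15 * q ^ 4 - 4 / 7 * q ^ 5 + 1 / 5 * q ^ 6) := by unfold primitivePoly; ring
  rw [e]
  refine mul_nonpos_of_nonneg_of_nonpos (by positivity) ?_
  nlinarith [sq_nonneg (q - 5 / 12)]

/-- This expression is, up to a nonnegative factor, the defect between the integrand and the
derivative of its approximate primitive. -/
theorem primitivePoly_bound {q : ℝ} (hq : 0 ≤ q) (hq1 : q ≤ 1) :
    0 ≤ q * (1 - q) * weightPoly q * q * (1 - q ^ 2) + 2 * primitivePoly q := by
  have e : q * (1 - q) * weightPoly q * q * (1 - q ^ 2) + 2 * primitivePoly q =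
      q ^ 3 * (1 / 3 - q + 53 / 25 * q ^ 2 - 8 / 3 * q ^ 3 + 58 / 35 * q ^ 4 - 2 / 5 * q ^ 5) := by
    unfold weightPoly primitivePoly; ring
  rw [e]
  refine mul_nonneg (by positivity) ?_
  have h5 : q ^ 5 ≤ q ^ 4 := pow_le_pow_of_le_one hq hq1 (by norm_num)
  -- Once q⁵ is replaced by q⁴, the quartic is, up to rounding, the square of the first quadratic
  -- plus a positive quadratic with vertex near 1.02.
  nlinarith [sq_nonneg (1.1211 * q ^ 2 - 1.1894 * q + 0.2), sq_nonneg (q - 1.02)]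

theorem hasDerivAt_primitivePoly (q : ℝ) : HasDerivAt primitivePoly
    (q * (1 - q) * weightPoly q * (2 * q ^ 2 + 2 * q - 1)) q := by
  have h := ((((((((hasDerivAt_pow 2 q).const_mul (-1 / 2)).add
    ((hasDerivAt_pow 3 q).const_mul (5 / 3))).sub ((hasDerivAt_pow 4 q).const_mul 2)).add
    ((hasDerivAt_pow 5 q).const_mul (24 / 25))).add ((hasDerivAt_pow 6 q).const_mul (4 / 15))).sub
    ((hasDerivAt_pow 7 q).const_mul (4 / 7))).add ((hasDerivAt_pow 8 q).const_mul (1 / 5)))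
  refine h.congr_deriv ?_
  unfold weightPoly
  push_cast; ring

theorem hasDerivAt_primitivePoly_div {Y q : ℝ} (hE : modSq Y q ≠ 0) :
    HasDerivAt (fun q => primitivePoly q / modSq Y q)
      ((q * (1 - q) * weightPoly q * (2 * q ^ 2 + 2 * q - 1) * modSq Y q
        - primitivePoly q * (2 * Y * q)) / modSq Y q ^ 2) q := by
  have h : HasDerivAt (modSq Y) (2 * Y * q) q := by
    refine ((((hasDerivAt_pow 2 q).const_sub 1).const_mul Y).const_sub 1).congr_deriv ?_
    push_cast; ring
  exact (hasDerivAt_primitivePoly q).div h hE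

theorem hasDerivAt_cayley_mul {r t : ℝ} (h : 1 + r * t ≠ 0) :
    HasDerivAt (fun t => cayley (r * t)) (-(r * (1 + cayley (r * t)) ^ 2 / 2)) t := by
  have h1 := (hasDerivAt_id t).const_mul r
  refine ((h1.const_sub 1).div (h1.const_add 1) h).congr_deriv ?_
  unfold cayley
  simp only [id]
  field_simp
  ring

theorem continuousOn_cayley_mul {r : ℝ} (hr : 0 ≤ r) :
    ContinuousOn (fun t => cayley (r * t)) (Icc 0 1) := by
  intro t ht
  refine (hasDerivAt_cayley_mul ?_).continuousAt.continuousWithinAt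
  have := mul_nonneg hr ht.1
  positivity

theorem continuous_modSq (Y : ℝ) : Continuous (modSq Y) := by unfold modSq; fun_prop

theorem continuous_signFactor (Y : ℝ) : Continuous (signFactor Y) := by
  unfold signFactor modSq; fun_prop

theorem continuousOn_lowerKernel {Y r : ℝ} (hY : Y ≤ 1) (hr : 0 ≤ r) (hr1 : r < 1) :
    ContinuousOn (fun t => lowerKernel Y (cayley (r * t))) (Icc 0 1) := by
  have hc := continuousOn_cayley_mul hr
  unfold lowerKernel
  refine ContinuousOn.div ?_ (((continuous_modSq Y).comp_continuousOn hc).pow 2) ?_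
  · exact (continuousOn_const.mul (continuousOn_const.sub (hc.pow 2))).mul
      ((continuous_signFactor Y).comp_continuousOn hc)
  · intro t ht
    have h0 := mul_nonneg hr ht.1
    have : r * t < 1 := by nlinarith [ht.2]
    exact pow_ne_zero _ (modSq_pos hY (cayley_pos h0 this) (cayley_le_one h0)).ne'

/-- With P = `primitivePoly` and E = `modSq`, the function -(Y/2) P(q)/E(q) of t has derivative at
most r times the integrand. The integral is therefore bounded below by boundary values: P(1) ≥ 0 at
t = 0, and P ≤ 0 at t = 1, where the nonpositive sign factor forces 2q² + 2q ≤ 1. -/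
theorem integral_refWeight_mul_lowerKernel_nonneg {Y r : ℝ} (hY0 : 0 ≤ Y) (hY : Y ≤ 1)
    (hr : 0 < r) (hr1 : r < 1) (hneg : signFactor Y (cayley r) ≤ 0) :
    0 ≤ ∫ t in (0 : ℝ)..1, refWeight (cayley (r * t)) * lowerKernel Y (cayley (r * t)) := by
  have hmem : ∀ t ∈ Icc (0 : ℝ) 1, 0 < 1 + r * t ∧ 0 < cayley (r * t) ∧ cayley (r * t) ≤ 1 := by
    intro t ht
    have h0 := mul_nonneg hr.le ht.1
    exact ⟨by linarith, cayley_pos h0 (by nlinarith [ht.2]), cayley_le_one h0⟩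
  have hder : ∀ t ∈ Icc (0 : ℝ) 1, HasDerivAt
      (fun t => -(Y / 2) * (primitivePoly (cayley (r * t)) / modSq Y (cayley (r * t)))) _ t :=
    fun t ht => ((HasDerivAt.comp t (hasDerivAt_primitivePoly_div
      (modSq_pos hY (hmem t ht).2.1 (hmem t ht).2.2).ne')
      (hasDerivAt_cayley_mul (hmem t ht).1.ne')).const_mul (-(Y / 2)))
  have hcont : ContinuousOn
      (fun t => refWeight (cayley (r * t)) * lowerKernel Y (cayley (r * t))) (Icc 0 1) := by
    refine ContinuousOn.mul ?_ (continuousOn_lowerKernel hY hr.le hr1)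
    have : Continuous refWeight := by unfold refWeight weightPoly; fun_prop
    exact this.comp_continuousOn (continuousOn_cayley_mul hr.le)
  have key := intervalIntegral.sub_le_integral_of_hasDeriv_right_of_le (zero_le_one' ℝ)
    (g := fun t => -(Y / 2) * (primitivePoly (cayley (r * t)) / modSq Y (cayley (r * t))))
    (φ := fun t => r * (refWeight (cayley (r * t)) * lowerKernel Y (cayley (r * t))))
    (fun t ht => (hder t ht).continuousAt.continuousWithinAt)
    (fun t ht => (hder t (Ioo_subset_Icc_self ht)).hasDerivWithinAt)
    ((continuousOn_const.mul hcont).integrableOn_Icc) ?_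
  · rw [intervalIntegral.integral_const_mul] at key
    refine nonneg_of_mul_nonneg_right (le_trans ?_ key) hr
    have h0 : cayley (r * 0) = 1 := by simp [cayley]
    have hm1 : modSq Y 1 = 1 := by simp [modSq]
    have hq := hmem 1 (by simp)
    simp only [h0, hm1, mul_one, div_one] at hq ⊢
    obtain ⟨-, hq0, hq1⟩ := hq
    have hE := modSq_pos hY hq0 hq1
    have hE1 : modSq Y (cayley r) ≤ 1 := by
      unfold modSq
      have : 0 ≤ 1 - cayley r ^ 2 := by nlinarith
      nlinarith [mul_nonneg hY0 this]
    have hP : primitivePoly (cayley r) ≤ 0 := by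
      refine primitivePoly_nonpos hq0.le ?_
      by_contra hcon
      have h1 : 0 ≤ 1 - Y := by linarith
      have e : signFactor Y (cayley r) = (1 - Y) * (2 * cayley r ^ 2 + 2 * cayley r - 1) +
          Y * (2 * cayley r ^ 3 + cayley r ^ 4) := by unfold signFactor modSq; ring
      have h2 : 0 < 2 * cayley r ^ 2 + 2 * cayley r - 1 := by linarith
      have h3 : 0 < 2 * cayley r ^ 3 + cayley r ^ 4 := by positivity
      rcases hY0.eq_or_lt with h | h
      · rw [e, ← h] at hneg; linarith
      · rw [e] at hneg
        linarith [mul_nonneg h1 h2.le, mul_pos h h3]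
    have hPE : primitivePoly (cayley r) / modSq Y (cayley r) ≤ 0 :=
      div_nonpos_of_nonpos_of_nonneg hP hE.le
    nlinarith [primitivePoly_one_nonneg]
  · intro t ht
    obtain ⟨h1, hq0, hq1⟩ := hmem t (Ioo_subset_Icc_self ht)
    set q := cayley (r * t) with hq
    have hE := modSq_pos hY hq0 hq1
    have hb := primitivePoly_bound hq0.le hq1
    rw [← sub_nonneg]
    -- Since 1 - E = Y(1 - q²), the sign factor exceeds (2q² + 2q - 1)E by Yq²(1 - q²); this surplus
    -- joins the term from differentiating 1/E.
    have e : r * (refWeight q * lowerKernel Y q) - -(Y / 2) *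
        ((q * (1 - q) * weightPoly q * (2 * q ^ 2 + 2 * q - 1) * modSq Y q
        - primitivePoly q * (2 * Y * q)) / modSq Y q ^ 2 * -(r * (1 + q) ^ 2 / 2)) =
        (Y / 2) * (r * (1 + q) ^ 2 / 2) * (Y * q) *
          (q * (1 - q) * weightPoly q * q * (1 - q ^ 2) + 2 * primitivePoly q)
          / modSq Y q ^ 2 := by
      unfold refWeight lowerKernel signFactor
      field_simp
      unfold modSq
      ring
    rw [e]
    positivity

/-! ### Comparison of weights across a single sign change -/

theorem _root_.MeasureTheory.IntegrableOn.mul_continuousOn_Ioo {φ k : ℝ → ℝ}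
    (hφi : IntegrableOn φ (Ioo 0 1)) (hk : ContinuousOn k (Icc 0 1)) :
    IntegrableOn (fun t => φ t * k t) (Ioo 0 1) := by
  obtain ⟨B, hB⟩ := isCompact_Icc.exists_bound_of_continuousOn hk
  refine Integrable.mul_bdd (c := B) hφi
    ((hk.mono Ioo_subset_Icc_self).aestronglyMeasurable measurableSet_Ioo) ?_
  exact (ae_restrict_mem measurableSet_Ioo).mono fun t ht => hB t (Ioo_subset_Icc_self ht)

/-- A weight `φ ≥ 0` with `φ(t) / (1 - t)` decreasing integrates `lowerKernel` to something
nonnegative: the kernel changes sign at most once, from `+` to `-`. -/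
theorem integral_mul_lowerKernel_nonneg {φ : ℝ → ℝ} (hφi : IntegrableOn φ (Ioo 0 1))
    (hφ0 : ∀ t ∈ Ioo (0 : ℝ) 1, 0 ≤ φ t) (hφ : AntitoneOn (fun t => φ t / (1 - t)) (Ioo 0 1))
    {Y r : ℝ} (hY0 : 0 ≤ Y) (hY : Y ≤ 1) (hr : 0 < r) (hr1 : r < 1) :
    0 ≤ ∫ t in Ioo (0 : ℝ) 1, φ t * lowerKernel Y (cayley (r * t)) := by
  have hmem : ∀ t ∈ Icc (0 : ℝ) 1, 0 < 1 + r * t ∧ 0 < cayley (r * t) ∧ cayley (r * t) ≤ 1 := by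
    intro t ht
    have h0 := mul_nonneg hr.le ht.1
    exact ⟨by linarith, cayley_pos h0 (by nlinarith [ht.2]), cayley_le_one h0⟩
  have hsign : ∀ t ∈ Icc (0 : ℝ) 1, ∃ M, 0 ≤ M ∧
      lowerKernel Y (cayley (r * t)) = M * signFactor Y (cayley (r * t)) := by
    intro t ht
    obtain ⟨h1, hq0, hq1⟩ := hmem t ht
    refine ⟨Y / 4 * (1 - cayley (r * t) ^ 2) / modSq Y (cayley (r * t)) ^ 2, ?_, ?_⟩
    · have : 0 ≤ 1 - cayley (r * t) ^ 2 := by nlinarith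
      positivity
    · unfold lowerKernel; ring
  by_cases hall : ∀ t ∈ Ioo (0 : ℝ) 1, 0 ≤ signFactor Y (cayley (r * t))
  · refine setIntegral_nonneg measurableSet_Ioo fun t ht => ?_
    obtain ⟨M, hM, e⟩ := hsign t (Ioo_subset_Icc_self ht)
    rw [e]
    exact mul_nonneg (hφ0 t ht) (mul_nonneg hM (hall t ht))
  push Not at hall
  obtain ⟨t₁, ht₁, hneg⟩ := hall
  have hmono : ∀ s ∈ Icc (0 : ℝ) 1, ∀ t ∈ Icc (0 : ℝ) 1, s ≤ t →
      signFactor Y (cayley (r * t)) ≤ signFactor Y (cayley (r * s)) := fun s hs t ht hst =>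
    signFactor_mono hY0 hY (hmem t ht).2.1.le
      (cayley_anti (mul_nonneg hr.le hs.1) (by gcongr))
  -- At t = 0 the coordinate q is 1 and the sign factor is 3, so the intermediate value theorem
  -- locates the sign change.
  obtain ⟨t₀, ht₀, hzero⟩ : ∃ t₀ ∈ Ioo (0 : ℝ) t₁, signFactor Y (cayley (r * t₀)) = 0 := by
    have hc : ContinuousOn (fun t => signFactor Y (cayley (r * t))) (Icc 0 t₁) :=
      ((continuous_signFactor Y).comp_continuousOn (continuousOn_cayley_mul hr.le)).mono
        (Icc_subset_Icc_right ht₁.2.le)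
    refine intermediate_value_Ioo' ht₁.1.le hc ⟨hneg, ?_⟩
    simp [cayley, signFactor, modSq]
    norm_num
  have ht₀' : t₀ ∈ Ioo (0 : ℝ) 1 := ⟨ht₀.1, ht₀.2.trans ht₁.2⟩
  have hrefpos : ∀ t ∈ Icc (0 : ℝ) 1, 0 < refWeight (cayley (r * t)) := by
    intro t ht
    obtain ⟨h1, hq0, hq1⟩ := hmem t ht
    have := weightPoly_pos hq1
    unfold refWeight; positivity
  -- The ratio splits into three nonnegative decreasing factors: φ/(1 - t), (1 - t)/(1 - rt) with r
  -- < 1, and the reciprocal of an increasing function.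
  have hanti : ∀ s ∈ Ioo (0 : ℝ) 1, ∀ t ∈ Ioo (0 : ℝ) 1, s ≤ t →
      φ t / refWeight (cayley (r * t)) ≤ φ s / refWeight (cayley (r * s)) := by
    have e : ∀ t ∈ Ioo (0 : ℝ) 1, φ t / refWeight (cayley (r * t)) =
        φ t / (1 - t) * ((1 - t) / (1 - r * t) *
          (2 / ((1 + cayley (r * t)) ^ 2 * weightPoly (cayley (r * t))))) := by
      intro t ht
      obtain ⟨h1, hq0, hq1⟩ := hmem t (Ioo_subset_Icc_self ht)
      have hw := (weightPoly_pos hq1).ne'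
      have h2 : 1 - t ≠ 0 := by linarith [ht.2]
      have h3 : (1 - r * t) * (1 + cayley (r * t)) = 2 * cayley (r * t) := by
        unfold cayley; field_simp; ring
      have h4 : 1 - r * t ≠ 0 := by nlinarith [ht.2, ht.1]
      have h5 : 1 + cayley (r * t) ≠ 0 := by positivity
      have h6 : 1 - r * t = 2 * cayley (r * t) / (1 + cayley (r * t)) := by
        rw [← h3]; field_simp
      rw [h6]
      unfold refWeight
      field_simp
    intro s hs t ht hst
    rw [e s hs, e t ht]
    obtain ⟨-, hp0, hp1⟩ := hmem s (Ioo_subset_Icc_self hs)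
    obtain ⟨-, hq0, hq1⟩ := hmem t (Ioo_subset_Icc_self ht)
    have a1 := hφ hs ht hst
    have hrs : 0 < 1 - r * s := by nlinarith [hs.1, hs.2]
    have hrt : 0 < 1 - r * t := by nlinarith [ht.1, ht.2]
    have a2 : (1 - t) / (1 - r * t) ≤ (1 - s) / (1 - r * s) := by
      rw [div_le_div_iff₀ hrt hrs]; nlinarith [mul_nonneg (sub_nonneg.2 hst) (sub_nonneg.2 hr1.le)]
    have a3 := antitoneOn_sq_mul_weightPoly ⟨hq0.le, hq1⟩ ⟨hp0.le, hp1⟩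
      (cayley_anti (mul_nonneg hr.le hs.1.le) (mul_le_mul_of_nonneg_left hst hr.le))
    have w1 := weightPoly_pos hp1
    have w2 := weightPoly_pos hq1
    have s0 : 0 ≤ φ s / (1 - s) := div_nonneg (hφ0 s hs) (by linarith [hs.2])
    have t0 : 0 ≤ (1 - t) / (1 - r * t) := div_nonneg (by linarith [ht.2]) hrt.le
    have s1 : 0 ≤ (1 - s) / (1 - r * s) := div_nonneg (by linarith [hs.2]) hrs.le
    refine mul_le_mul a1 (mul_le_mul a2 ?_ (by positivity) s1) (by positivity) s0
    exact div_le_div_of_nonneg_left (by norm_num) (by positivity) a3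
  -- C is the ratio at the sign change, so φ/`refWeight` - C and the kernel have the same sign
  -- throughout; hence φ · kernel ≥ C · `refWeight` · kernel.
  set C := φ t₀ / refWeight (cayley (r * t₀)) with hC
  have hC0 : 0 ≤ C := div_nonneg (hφ0 _ ht₀') (hrefpos _ (Ioo_subset_Icc_self ht₀')).le
  have hkc := continuousOn_lowerKernel hY hr.le hr1
  have hrefc : ContinuousOn (fun t => refWeight (cayley (r * t))) (Icc 0 1) := by
    have : Continuous refWeight := by unfold refWeight weightPoly; fun_prop
    exact this.comp_continuousOn (continuousOn_cayley_mul hr.le)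
  have h1neg : signFactor Y (cayley r) ≤ 0 := by
    have := hmono t₁ (Ioo_subset_Icc_self ht₁) 1 (by simp) ht₁.2.le
    rw [mul_one] at this
    linarith
  have hnn := integral_refWeight_mul_lowerKernel_nonneg hY0 hY hr hr1 h1neg
  rw [intervalIntegral.integral_of_le zero_le_one, integral_Ioc_eq_integral_Ioo] at hnn
  refine (mul_nonneg hC0 hnn).trans ?_
  rw [← integral_const_mul]
  refine setIntegral_mono_on
    ((continuousOn_const.mul (hrefc.mul hkc)).integrableOn_Icc.mono_set Ioo_subset_Icc_self)
    (hφi.mul_continuousOn_Ioo hkc) measurableSet_Ioo fun t ht => ?_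
  have htI := Ioo_subset_Icc_self ht
  obtain ⟨M, hM, e⟩ := hsign t htI
  have e2 : φ t = φ t / refWeight (cayley (r * t)) * refWeight (cayley (r * t)) := by
    rw [div_mul_cancel₀ _ (hrefpos t htI).ne']
  rw [e2, e, mul_assoc]
  have hR := (hrefpos t htI).le
  have : 0 ≤ (φ t / refWeight (cayley (r * t)) - C) * signFactor Y (cayley (r * t)) := by
    rcases le_total t t₀ with h | h
    · exact mul_nonneg (sub_nonneg.2 (hanti t ht t₀ ht₀' h))
        (hzero ▸ hmono t htI t₀ (Ioo_subset_Icc_self ht₀') h)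
    · exact mul_nonneg_of_nonpos_of_nonpos (sub_nonpos.2 (hanti t₀ ht₀' t ht h))
        (hzero ▸ hmono t₀ (Ioo_subset_Icc_self ht₀') t htI h)
  nlinarith [mul_nonneg (mul_nonneg hR hM) this]

/-! ### The extremal inequality for the kernel -/

theorem lowerKernel_le {ζ w : ℂ} {s Y : ℝ} (hs : ‖ζ‖ = s) (hs1 : s < 1)
    (hre : ζ.re = s * (2 * Y - 1)) (hw : ‖w - 1 / 2‖ ≤ 1 / 2) :
    lowerKernel Y (cayley s) ≤ ((1 + (w - 1) * ζ) / (1 - ζ) ^ 2).re - 1 / (1 + s) ^ 2 := by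
  have hs0 : 0 ≤ s := hs ▸ norm_nonneg _
  have hne : 1 - ζ ≠ 0 := by
    intro h
    have : ζ = 1 := by linear_combination -h
    rw [this, norm_one] at hs
    linarith
  have hsq : s ^ 2 = ζ.re ^ 2 + ζ.im ^ 2 := by
    rw [← hs, ← Complex.normSq_eq_norm_sq, Complex.normSq_apply]; ring
  set D : ℝ := 1 - 2 * ζ.re + s ^ 2 with hD
  have hDn : ‖1 - ζ‖ ^ 2 = D := by
    rw [← Complex.normSq_eq_norm_sq, Complex.normSq_apply, hD, hsq]
    simp; ring
  have hDpos : 0 < D := hDn ▸ pow_pos (norm_pos_iff.2 hne) 2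
  -- Centring w at 1/2 isolates its effect, whose real part is at least -|ζ|/(2|1 - ζ|²). What
  -- remains depends only on |ζ| and Re ζ and equals `lowerKernel` exactly.
  have hsplit : (1 + (w - 1) * ζ) / (1 - ζ) ^ 2 =
      (1 - ζ / 2) / (1 - ζ) ^ 2 + (w - 1 / 2) * (ζ / (1 - ζ) ^ 2) := by
    field_simp; ring
  have h1 : -(1 / 2 * (s / D)) ≤ ((w - 1 / 2) * (ζ / (1 - ζ) ^ 2)).re := by
    have h2 : ‖(w - 1 / 2) * (ζ / (1 - ζ) ^ 2)‖ ≤ 1 / 2 * (s / D) := by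
      rw [norm_mul, norm_div, norm_pow, hDn, hs]
      have : 0 ≤ s / D := by positivity
      gcongr
    have := Complex.abs_re_le_norm ((w - 1 / 2) * (ζ / (1 - ζ) ^ 2))
    linarith [neg_abs_le ((w - 1 / 2) * (ζ / (1 - ζ) ^ 2)).re]
  have h3 : ((1 - ζ / 2) / (1 - ζ) ^ 2).re =
      (1 - 5 / 2 * ζ.re + 2 * ζ.re ^ 2 - s ^ 2 * ζ.re / 2) / D ^ 2 := by
    have hn : Complex.normSq ((1 - ζ) ^ 2) = D ^ 2 := by
      rw [map_pow, Complex.normSq_eq_norm_sq, hDn]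
    rw [Complex.div_re, hn, ← add_div]
    congr 1
    rw [hsq]
    simp [pow_two]
    ring
  rw [hsplit, Complex.add_re, h3]
  refine le_trans (le_of_eq ?_) (sub_le_sub_right (add_le_add_right h1 _) _)
  have hE : modSq Y (cayley s) = D / (1 + s) ^ 2 := by
    rw [hD, hre]; unfold modSq cayley; field_simp; ring
  unfold lowerKernel signFactor
  rw [hE]
  have hD' : D = 1 - 2 * (s * (2 * Y - 1)) + s ^ 2 := by rw [hD, hre]
  have hs2 : (1 + s) ≠ 0 := by positivity
  rw [hre]
  unfold cayley
  field_simp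
  rw [hD']
  ring

theorem continuousOn_re_kernel {z : ℂ} (hz : ‖z‖ < 1) (w : ℂ) :
    ContinuousOn (fun t : ℝ => ((1 + (w - 1) * (t * z)) / (1 - t * z) ^ 2).re) (Icc 0 1) := by
  refine Complex.continuous_re.comp_continuousOn (ContinuousOn.div (by fun_prop) (by fun_prop) ?_)
  intro t ht h
  have h1 : (t : ℂ) * z = 1 := by linear_combination -(pow_eq_zero_iff two_ne_zero).1 h
  have h2 := congrArg norm h1
  rw [norm_mul, Complex.norm_real, Real.norm_of_nonneg ht.1, norm_one] at h2
  nlinarith [ht.1, ht.2, norm_nonneg z]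

theorem continuousOn_one_div_one_add_sq :
    ContinuousOn (fun t : ℝ => 1 / (1 + t) ^ 2) (Icc 0 1) := by
  refine ContinuousOn.div (by fun_prop) (by fun_prop) fun t ht => ?_
  have := ht.1
  positivity

/-- The extremal property of weights `φ` for which `φ(t) / (1 - t)` decreases. -/
theorem integral_mul_re_kernel_nonneg {φ : ℝ → ℝ} (hφi : IntegrableOn φ (Ioo 0 1))
    (hφ0 : ∀ t ∈ Ioo (0 : ℝ) 1, 0 ≤ φ t) (hφ : AntitoneOn (fun t => φ t / (1 - t)) (Ioo 0 1))
    {z w : ℂ} (hz : ‖z‖ < 1) (hw : ‖w - 1 / 2‖ ≤ 1 / 2) :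
    0 ≤ ∫ t in Ioo (0 : ℝ) 1, φ t *
      (((1 + (w - 1) * (t * z)) / (1 - t * z) ^ 2).re - 1 / (1 + t) ^ 2) := by
  -- The lower kernel subtracts 1/(1 + |z|t)², which is at least the 1/(1 + t)² required.
  have hdec : ∀ t ∈ Ioo (0 : ℝ) 1, 1 / (1 + t) ^ 2 ≤ 1 / (1 + ‖z‖ * t) ^ 2 := by
    intro t ht
    have h0 := norm_nonneg z
    have h1 := mul_nonneg h0 ht.1.le
    have : ‖z‖ * t ≤ t := by nlinarith [ht.1]
    gcongr
  rcases eq_or_ne z 0 with rfl | hz0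
  · refine setIntegral_nonneg measurableSet_Ioo fun t ht => mul_nonneg (hφ0 t ht) ?_
    simpa using hdec t ht
  have hr : 0 < ‖z‖ := norm_pos_iff.2 hz0
  set Y : ℝ := (1 + z.re / ‖z‖) / 2 with hYdef
  have habs := abs_le.1 (Complex.abs_re_le_norm z)
  have hY0 : 0 ≤ Y := by
    have : -1 ≤ z.re / ‖z‖ := by rw [le_div_iff₀ hr]; linarith
    rw [hYdef]; linarith
  have hY1 : Y ≤ 1 := by
    have : z.re / ‖z‖ ≤ 1 := by rw [div_le_iff₀ hr]; linarith
    rw [hYdef]; linarith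
  have hk := integral_mul_lowerKernel_nonneg hφi hφ0 hφ hY0 hY1 hr hz
  refine hk.trans (setIntegral_mono_on
    (hφi.mul_continuousOn_Ioo (continuousOn_lowerKernel hY1 hr.le hz))
    (hφi.mul_continuousOn_Ioo ((continuousOn_re_kernel hz w).sub continuousOn_one_div_one_add_sq))
    measurableSet_Ioo fun t ht => mul_le_mul_of_nonneg_left ?_ (hφ0 t ht))
  have hn : ‖(t : ℂ) * z‖ = ‖z‖ * t := by
    rw [norm_mul, Complex.norm_real, Real.norm_of_nonneg ht.1.le, mul_comm]
  refine (lowerKernel_le (w := w) hn (by nlinarith [ht.1, ht.2]) ?_ hw).trans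
    (sub_le_sub_left (hdec t ht) _)
  rw [Complex.re_ofReal_mul, hYdef]
  field_simp
  ring

/-! ### Bernardi averages -/

section AverageOperator

variable {E : Type*} [NormedAddCommGroup E] [NormedSpace ℝ E]

/-- The Bernardi average `∫₀¹ u ^ (e - 1) F(s u) du`. -/
noncomputable def avgOp (e : ℝ) (F : ℝ → E) (s : ℝ) : E :=
  ∫ u in Ioo (0 : ℝ) 1, u ^ (e - 1) • F (s * u)

/-- `F(x) = ∑ cₙ xⁿ` on `[0, s]`, with absolute convergence. -/
def HasSeriesOn (s : ℝ) (c : ℕ → E) (F : ℝ → E) : Prop :=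
  (Summable fun n => ‖c n‖ * s ^ n) ∧ ∀ x ∈ Icc 0 s, HasSum (fun n => x ^ n • c n) (F x)

theorem integrableOn_rpow_sub_one {e : ℝ} (he : 0 < e) :
    IntegrableOn (fun u : ℝ => u ^ (e - 1)) (Ioo 0 1) := by
  have := intervalIntegral.intervalIntegrable_rpow' (a := 0) (b := 1)
    (show -1 < e - 1 by linarith)
  exact (intervalIntegrable_iff_integrableOn_Ioo_of_le zero_le_one).1 this

theorem integral_rpow_sub_one {e : ℝ} (he : 0 < e) :
    ∫ u in Ioo (0 : ℝ) 1, u ^ (e - 1) = e⁻¹ := by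
  rw [← integral_Ioc_eq_integral_Ioo, ← intervalIntegral.integral_of_le zero_le_one,
    integral_rpow (Or.inl (by linarith))]
  simp [he.ne']

theorem integral_rpow_sub_one_mul_pow {e : ℝ} (he : 0 < e) (n : ℕ) :
    ∫ u in Ioo (0 : ℝ) 1, u ^ (e - 1) * u ^ n = (n + e)⁻¹ := by
  rw [← integral_rpow_sub_one (show 0 < n + e by positivity)]
  refine setIntegral_congr_fun measurableSet_Ioo fun u hu => ?_
  rw [← Real.rpow_natCast, ← Real.rpow_add hu.1]
  ring_nf

theorem HasSeriesOn.mono {s r : ℝ} {c : ℕ → E} {F : ℝ → E} (h : HasSeriesOn s c F) (hr : 0 ≤ r)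
    (hrs : r ≤ s) : HasSeriesOn r c F := by
  refine ⟨h.1.of_nonneg_of_le (fun n => by positivity) fun n => ?_,
    fun x hx => h.2 x ⟨hx.1, hx.2.trans hrs⟩⟩
  gcongr

variable [CompleteSpace E]

theorem HasSeriesOn.hasSum_avgOp {s e : ℝ} (hs : 0 ≤ s) (he : 0 < e) {c : ℕ → E} {F : ℝ → E}
    (h : HasSeriesOn s c F) :
    HasSum (fun n : ℕ => s ^ n • ((n + e)⁻¹ • c n)) (avgOp e F s) := by
  have h1 := hasSum_integral_of_dominated_convergence
    (μ := volume.restrict (Ioo (0 : ℝ) 1))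
    (F := fun (n : ℕ) (u : ℝ) => (u ^ (e - 1) * u ^ n) • (s ^ n • c n))
    (f := fun u => u ^ (e - 1) • F (s * u))
    (fun (n : ℕ) (u : ℝ) => u ^ (e - 1) * (‖c n‖ * s ^ n))
    (fun n => by
      refine AEStronglyMeasurable.smul_const ?_ _
      exact (integrableOn_rpow_sub_one he).aestronglyMeasurable.mul
        (continuous_pow n).aestronglyMeasurable)
    (fun n => (ae_restrict_mem measurableSet_Ioo).mono fun u hu => by
      have h0 := Real.rpow_nonneg hu.1.le (e - 1)
      have h1 : u ^ n ≤ 1 := pow_le_one₀ hu.1.le hu.2.le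
      have h2 : 0 ≤ u ^ n := pow_nonneg hu.1.le n
      rw [norm_smul, norm_smul, Real.norm_of_nonneg (mul_nonneg h0 h2),
        Real.norm_of_nonneg (pow_nonneg hs n), mul_comm (s ^ n)]
      have h3 : 0 ≤ ‖c n‖ * s ^ n := by positivity
      refine mul_le_mul_of_nonneg_right ?_ h3
      exact mul_le_of_le_one_right h0 h1)
    (ae_of_all _ fun u => h.1.mul_left _)
    (by
      simp_rw [tsum_mul_left]
      exact (integrableOn_rpow_sub_one he).mul_const _)
    ((ae_restrict_mem measurableSet_Ioo).mono fun u hu => by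
      refine ((h.2 (s * u) ⟨mul_nonneg hs hu.1.le, mul_le_of_le_one_right hs hu.2.le⟩).const_smul
        (u ^ (e - 1))).congr_fun fun n => ?_
      rw [mul_pow, smul_smul, smul_smul]
      ring_nf)
  refine h1.congr_fun fun n => ?_
  rw [integral_smul_const, integral_rpow_sub_one_mul_pow he, smul_smul, smul_smul, mul_comm]

theorem HasSeriesOn.avgOp {s e : ℝ} (hs : 0 ≤ s) (he : 0 < e) {c : ℕ → E} {F : ℝ → E}
    (h : HasSeriesOn s c F) :
    HasSeriesOn s (fun n : ℕ => ((n : ℝ) + e)⁻¹ • c n) (avgOp e F) := by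
  refine ⟨?_, fun x hx => (h.mono hx.1 hx.2).hasSum_avgOp hx.1 he⟩
  refine (h.1.mul_left e⁻¹).of_nonneg_of_le (fun n => by positivity) fun n => ?_
  rw [norm_smul, Real.norm_of_nonneg (by positivity), mul_assoc]
  gcongr
  simp

end AverageOperator

theorem norm_avgOp_le {e C : ℝ} (he : 0 < e) {F : ℝ → ℝ} (hF : ∀ x ∈ Icc (0 : ℝ) 1, |F x| ≤ C)
    {s : ℝ} (hs : s ∈ Icc (0 : ℝ) 1) : |avgOp e F s| ≤ C * e⁻¹ := by
  rw [← integral_rpow_sub_one he, ← integral_const_mul, avgOp, ← Real.norm_eq_abs]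
  refine norm_integral_le_of_norm_le ((integrableOn_rpow_sub_one he).const_mul _) ?_
  refine (ae_restrict_mem measurableSet_Ioo).mono fun u hu => ?_
  have h0 := Real.rpow_nonneg hu.1.le (e - 1)
  rw [smul_eq_mul, Real.norm_eq_abs, abs_mul, abs_of_nonneg h0, mul_comm C]
  exact mul_le_mul_of_nonneg_left
    (hF _ ⟨mul_nonneg hs.1 hu.1.le, mul_le_one₀ hs.2 hu.1.le hu.2.le⟩) h0

theorem continuousOn_avgOp {e : ℝ} (he : 0 < e) {F : ℝ → ℝ} (hF : ContinuousOn F (Icc 0 1)) :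
    ContinuousOn (avgOp e F) (Icc 0 1) := by
  obtain ⟨C, hC⟩ := isCompact_Icc.exists_bound_of_continuousOn hF
  have hmem : ∀ s ∈ Icc (0 : ℝ) 1, ∀ u ∈ Ioo (0 : ℝ) 1, s * u ∈ Icc (0 : ℝ) 1 := fun s hs u hu =>
    ⟨mul_nonneg hs.1 hu.1.le, mul_le_one₀ hs.2 hu.1.le hu.2.le⟩
  refine continuousOn_of_dominated (bound := fun u => u ^ (e - 1) * C) (fun s hs => ?_)
    (fun s hs => ?_) ((integrableOn_rpow_sub_one he).mul_const C) ?_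
  · refine (integrableOn_rpow_sub_one he).aestronglyMeasurable.smul ?_
    exact (hF.comp (by fun_prop) fun u hu => hmem s hs u hu).aestronglyMeasurable measurableSet_Ioo
  · refine (ae_restrict_mem measurableSet_Ioo).mono fun u hu => ?_
    have h0 := Real.rpow_nonneg hu.1.le (e - 1)
    rw [norm_smul, Real.norm_of_nonneg h0]
    exact mul_le_mul_of_nonneg_left (hC _ (hmem s hs u hu)) h0
  · refine (ae_restrict_mem measurableSet_Ioo).mono fun u hu => ?_
    have h : ContinuousOn (fun s => F (s * u)) (Icc 0 1) :=
      hF.comp (by fun_prop) fun s hs => hmem s hs u hu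
    exact h.const_smul (u ^ (e - 1))

/-! ### Multiplicative convolution as the adjoint of averaging -/

/-- The density of the multiplicative convolution of `g` with `t ^ (e - 1)` on `(0, 1)`. -/
noncomputable def mulConv (e : ℝ) (g : ℝ → ℝ) (t : ℝ) : ℝ :=
  t ^ (e - 1) * ∫ s in Ioo t 1, g s * s ^ (-e)

theorem integral_Ioo_rpow_mul {e s : ℝ} (hs : 0 < s) (F : ℝ → ℝ) :
    ∫ t in Ioo 0 s, t ^ (e - 1) * F t = s ^ e * avgOp e F s := by
  have h := intervalIntegral.smul_integral_comp_mul_left (a := 0) (b := 1)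
    (fun t : ℝ => t ^ (e - 1) * F t) s
  rw [mul_zero, mul_one, intervalIntegral.integral_of_le hs.le,
    intervalIntegral.integral_of_le zero_le_one, integral_Ioc_eq_integral_Ioo,
    integral_Ioc_eq_integral_Ioo] at h
  rw [← h, avgOp, smul_eq_mul, ← integral_const_mul, ← integral_const_mul]
  refine setIntegral_congr_fun measurableSet_Ioo fun u hu => ?_
  simp only [smul_eq_mul]
  rw [Real.mul_rpow hs.le hu.1.le, Real.rpow_sub_one hs.ne']
  field_simp

theorem integrableOn_Ioo_rpow_mul {e s : ℝ} (he : 0 < e) (hs1 : s ≤ 1) {F : ℝ → ℝ}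
    (hF : ContinuousOn F (Icc 0 1)) :
    IntegrableOn (fun t => t ^ (e - 1) * F t) (Ioo 0 s) :=
  ((integrableOn_rpow_sub_one he).mul_continuousOn_Ioo hF).mono_set (Ioo_subset_Ioo_right hs1)

/-- This justifies Fubini on the triangle t < s: the inner integral of the absolute value produces
s^e, which cancels s^(-e) and leaves at most |g(s)| C/e. -/
theorem integrable_mulConv_kernel {e : ℝ} (he : 0 < e) {g F : ℝ → ℝ}
    (hg : IntegrableOn g (Ioo 0 1)) (hF : ContinuousOn F (Icc 0 1)) :
    Integrable (fun p : ℝ × ℝ => {p : ℝ × ℝ | p.2 < p.1}.indicator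
      (fun p => g p.1 * p.1 ^ (-e) * (p.2 ^ (e - 1) * F p.2)) p)
      ((volume.restrict (Ioo 0 1)).prod (volume.restrict (Ioo 0 1))) := by
  obtain ⟨C, hC⟩ := isCompact_Icc.exists_bound_of_continuousOn hF
  have hmeas : AEStronglyMeasurable (fun p : ℝ × ℝ => {p : ℝ × ℝ | p.2 < p.1}.indicator
      (fun p => g p.1 * p.1 ^ (-e) * (p.2 ^ (e - 1) * F p.2)) p)
      ((volume.restrict (Ioo 0 1)).prod (volume.restrict (Ioo 0 1))) := by
    refine AEStronglyMeasurable.indicator ?_ (measurableSet_lt measurable_snd measurable_fst)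
    refine AEStronglyMeasurable.mul ?_ ?_
    · exact (hg.aestronglyMeasurable.mul
        (measurable_id.pow_const (-e)).aestronglyMeasurable).comp_fst
    · exact ((integrableOn_rpow_sub_one he).mul_continuousOn_Ioo hF).aestronglyMeasurable.comp_snd
  have hind : ∀ s : ℝ, (fun t : ℝ => {p : ℝ × ℝ | p.2 < p.1}.indicator
      (fun p => g p.1 * p.1 ^ (-e) * (p.2 ^ (e - 1) * F p.2)) (s, t)) =
      (Iio s).indicator fun t => g s * s ^ (-e) * (t ^ (e - 1) * F t) := by
    intro s; ext t
    by_cases h : t < s <;> simp [indicator, h]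
  have hset : ∀ s ∈ Ioo (0 : ℝ) 1, Iio s ∩ Ioo 0 1 = Ioo 0 s := by
    intro s hs; ext t
    simp only [mem_inter_iff, mem_Iio, mem_Ioo]
    exact ⟨fun h => ⟨h.2.1, h.1⟩, fun h => ⟨h.2, h.1, h.2.trans hs.2⟩⟩
  rw [integrable_prod_iff hmeas]
  constructor
  · refine (ae_restrict_mem measurableSet_Ioo).mono fun s hs => ?_
    rw [hind s, integrable_indicator_iff measurableSet_Iio, IntegrableOn,
      Measure.restrict_restrict measurableSet_Iio, hset s hs]
    exact (integrableOn_Ioo_rpow_mul he hs.2.le hF).const_mul _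
  · refine Integrable.mono' (g := fun s => |g s| * (C * e⁻¹)) (hg.abs.mul_const _)
      hmeas.norm.integral_prod_right' ?_
    refine (ae_restrict_mem measurableSet_Ioo).mono fun s hs => ?_
    have e1 : ∀ t : ℝ, ‖{p : ℝ × ℝ | p.2 < p.1}.indicator
        (fun p => g p.1 * p.1 ^ (-e) * (p.2 ^ (e - 1) * F p.2)) (s, t)‖ =
        (Iio s).indicator (fun t => |g s| * s ^ (-e) * |t ^ (e - 1) * F t|) t := by
      intro t
      rw [congrFun (hind s) t, norm_indicator_eq_indicator_norm]
      congr 1; ext t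
      rw [Real.norm_eq_abs, abs_mul, abs_mul, abs_of_nonneg (Real.rpow_nonneg hs.1.le (-e))]
    simp_rw [e1]
    have e2 : ∫ t in Ioo (0 : ℝ) 1, (Iio s).indicator
        (fun t => |g s| * s ^ (-e) * |t ^ (e - 1) * F t|) t =
        |g s| * s ^ (-e) * (s ^ e * avgOp e (fun t => |F t|) s) := by
      rw [integral_indicator measurableSet_Iio, Measure.restrict_restrict measurableSet_Iio,
        hset s hs, integral_const_mul, ← integral_Ioo_rpow_mul hs.1]
      congr 1
      refine setIntegral_congr_fun measurableSet_Ioo fun t ht => ?_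
      rw [abs_mul, abs_of_nonneg (Real.rpow_nonneg ht.1.le _)]
    rw [e2, Real.norm_eq_abs, Real.rpow_neg hs.1.le]
    have hse := Real.rpow_pos_of_pos hs.1 e
    have e3 : |g s| * (s ^ e)⁻¹ * (s ^ e * avgOp e (fun t => |F t|) s) =
        |g s| * avgOp e (fun t => |F t|) s := by field_simp
    rw [e3, abs_mul, abs_abs]
    refine mul_le_mul_of_nonneg_left ?_ (abs_nonneg _)
    exact norm_avgOp_le he (fun x hx => by rw [abs_abs]; exact hC x hx)
      (Ioo_subset_Icc_self hs)

theorem integral_mulConv_kernel {e : ℝ} (g F : ℝ → ℝ) {t : ℝ} (ht : t ∈ Ioo (0 : ℝ) 1) :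
    ∫ s in Ioo (0 : ℝ) 1, {p : ℝ × ℝ | p.2 < p.1}.indicator
      (fun p => g p.1 * p.1 ^ (-e) * (p.2 ^ (e - 1) * F p.2)) (s, t) = mulConv e g t * F t := by
  have hind : (fun s : ℝ => {p : ℝ × ℝ | p.2 < p.1}.indicator
      (fun p => g p.1 * p.1 ^ (-e) * (p.2 ^ (e - 1) * F p.2)) (s, t)) =
      (Ioi t).indicator fun s => g s * s ^ (-e) * (t ^ (e - 1) * F t) := by
    ext s
    by_cases h : t < s <;> simp [indicator, h]
  have hset : Ioi t ∩ Ioo 0 1 = Ioo t 1 := by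
    ext s
    simp only [mem_inter_iff, mem_Ioi, mem_Ioo]
    exact ⟨fun h => ⟨h.1, h.2.2⟩, fun h => ⟨h.1, ht.1.trans h.1, h.2⟩⟩
  rw [hind, integral_indicator measurableSet_Ioi, Measure.restrict_restrict measurableSet_Ioi,
    hset, integral_mul_const, mulConv]
  ring

theorem integrableOn_mulConv {e : ℝ} (he : 0 < e) {g : ℝ → ℝ} (hg : IntegrableOn g (Ioo 0 1)) :
    IntegrableOn (mulConv e g) (Ioo 0 1) := by
  have h := (integrable_mulConv_kernel he hg (F := fun _ => 1) continuousOn_const).integral_prod_right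
  refine h.congr ((ae_restrict_mem measurableSet_Ioo).mono fun t ht => ?_)
  simpa using integral_mulConv_kernel g (fun _ => 1) ht

theorem integral_mulConv_mul {e : ℝ} (he : 0 < e) {g F : ℝ → ℝ} (hg : IntegrableOn g (Ioo 0 1))
    (hF : ContinuousOn F (Icc 0 1)) :
    ∫ t in Ioo (0 : ℝ) 1, mulConv e g t * F t = ∫ s in Ioo (0 : ℝ) 1, g s * avgOp e F s := by
  have h := integral_integral_swap (f := fun s t => {p : ℝ × ℝ | p.2 < p.1}.indicator
    (fun p => g p.1 * p.1 ^ (-e) * (p.2 ^ (e - 1) * F p.2)) (s, t))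
    (integrable_mulConv_kernel he hg hF)
  rw [← setIntegral_congr_fun measurableSet_Ioo fun t ht => integral_mulConv_kernel g F ht]
  rw [← h]
  refine setIntegral_congr_fun measurableSet_Ioo fun s hs => ?_
  have hind : (fun t : ℝ => {p : ℝ × ℝ | p.2 < p.1}.indicator
      (fun p => g p.1 * p.1 ^ (-e) * (p.2 ^ (e - 1) * F p.2)) (s, t)) =
      (Iio s).indicator fun t => g s * s ^ (-e) * (t ^ (e - 1) * F t) := by
    ext t
    by_cases h : t < s <;> simp [indicator, h]
  have hset : Iio s ∩ Ioo 0 1 = Ioo 0 s := by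
    ext t
    simp only [mem_inter_iff, mem_Iio, mem_Ioo]
    exact ⟨fun h => ⟨h.2.1, h.1⟩, fun h => ⟨h.2, h.1, h.2.trans hs.2⟩⟩
  have := Real.rpow_pos_of_pos hs.1 e
  simp only [hind]
  rw [integral_indicator measurableSet_Iio, Measure.restrict_restrict measurableSet_Iio,
    hset, integral_const_mul, integral_Ioo_rpow_mul hs.1, Real.rpow_neg hs.1.le]
  field_simp

/-! ### Monotonicity of convolutions divided by 1 - t -/

theorem antitoneOn_tail_average {f : ℝ → ℝ} (hf : AntitoneOn f (Ioo 0 1))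
    (hfi : ∀ t ∈ Ioo (0 : ℝ) 1, IntegrableOn f (Ioo t 1)) :
    AntitoneOn (fun t => (∫ s in Ioo t 1, f s) / (1 - t)) (Ioo 0 1) := by
  intro x hx y hy hxy
  rcases hxy.eq_or_lt with rfl | hlt
  · exact le_rfl
  have hx1 : 0 < 1 - x := by linarith [hx.2]
  have hy1 : 0 < 1 - y := by linarith [hy.2]
  have hunion : Ioo x 1 = Ioc x y ∪ Ioo y 1 := (Ioc_union_Ioo_eq_Ioo hlt.le hy.2).symm
  have hxi := hfi x hx
  have hsub : Ioc x y ⊆ Ioo x 1 := fun s hs => ⟨hs.1, hs.2.trans_lt hy.2⟩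
  have hsplit : ∫ s in Ioo x 1, f s = (∫ s in Ioc x y, f s) + ∫ s in Ioo y 1, f s := by
    rw [hunion]
    refine setIntegral_union ?_ measurableSet_Ioo (hxi.mono_set hsub) (hfi y hy)
    exact disjoint_left.2 fun s hs hs' => absurd hs'.1 (not_lt.2 hs.2)
  have h1 : f y * (y - x) ≤ ∫ s in Ioc x y, f s := by
    have : ∫ _ in Ioc x y, f y = f y * (y - x) := by
      simp [Measure.real, hxy, mul_comm]
    rw [← this]
    refine setIntegral_mono_on (integrableOn_const (by simp)) (hxi.mono_set hsub)
      measurableSet_Ioc fun s hs => ?_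
    exact hf ⟨hx.1.trans hs.1, hs.2.trans_lt hy.2⟩ hy hs.2
  have h2 : ∫ s in Ioo y 1, f s ≤ f y * (1 - y) := by
    have : ∫ _ in Ioo y 1, f y = f y * (1 - y) := by
      simp [Measure.real, hy.2.le, mul_comm]
    rw [← this]
    refine setIntegral_mono_on (hfi y hy) (integrableOn_const (by simp))
      measurableSet_Ioo fun s hs => ?_
    exact hf hy ⟨hy.1.trans hs.1, hs.2⟩ hs.1.le
  simp only
  -- The mean over (x, y] is at least f(y), and the mean over (y, 1) is at most f(y).
  rw [div_le_div_iff₀ hy1 hx1, hsplit]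
  nlinarith [mul_le_mul_of_nonneg_left h2 (sub_nonneg.2 hxy),
    mul_le_mul_of_nonneg_left h1 hy1.le]

theorem antitoneOn_rpow {r : ℝ} (hr : r ≤ 0) : AntitoneOn (fun t : ℝ => t ^ r) (Ioo 0 1) :=
  fun _ hx _ _ hxy => Real.rpow_le_rpow_of_nonpos hx.1 hxy hr

theorem AntitoneOn.mul_of_nonneg {f g : ℝ → ℝ} {S : Set ℝ} (hf : AntitoneOn f S)
    (hg : AntitoneOn g S) (hf0 : ∀ t ∈ S, 0 ≤ f t) (hg0 : ∀ t ∈ S, 0 ≤ g t) :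
    AntitoneOn (fun t => f t * g t) S := fun x hx y hy hxy =>
  mul_le_mul (hf hx hy hxy) (hg hx hy hxy) (hg0 y hy) (hf0 x hx)

theorem mulConv_nonneg {e : ℝ} {g : ℝ → ℝ} (hg : ∀ s ∈ Ioo (0 : ℝ) 1, 0 ≤ g s) {t : ℝ}
    (ht : t ∈ Ioo (0 : ℝ) 1) : 0 ≤ mulConv e g t := by
  refine mul_nonneg (Real.rpow_nonneg ht.1.le _)
    (setIntegral_nonneg measurableSet_Ioo fun s hs => ?_)
  have hs0 := ht.1.trans hs.1
  exact mul_nonneg (hg s ⟨hs0, hs.2⟩) (Real.rpow_nonneg hs0.le _)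

/-- The quotient is t^(e-1) times the average over (t, 1) of the decreasing function g(s) s^(-e). -/
theorem antitoneOn_mulConv_div {e : ℝ} (he : 0 < e) (he1 : e ≤ 1) {g : ℝ → ℝ}
    (hgi : IntegrableOn g (Ioo 0 1)) (hg0 : ∀ s ∈ Ioo (0 : ℝ) 1, 0 ≤ g s)
    (hg : AntitoneOn (fun s => g s * s ^ (-e)) (Ioo 0 1)) :
    AntitoneOn (fun t => mulConv e g t / (1 - t)) (Ioo 0 1) := by
  have hi : ∀ t ∈ Ioo (0 : ℝ) 1, IntegrableOn (fun s => g s * s ^ (-e)) (Ioo t 1) := by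
    intro t ht
    refine Integrable.mul_bdd (c := t ^ (-e)) (hgi.mono_set (Ioo_subset_Ioo_left ht.1.le))
      (measurable_id.pow_const (-e)).aestronglyMeasurable ?_
    refine (ae_restrict_mem measurableSet_Ioo).mono fun s hs => ?_
    have hs0 := ht.1.trans hs.1
    change ‖s ^ (-e)‖ ≤ t ^ (-e)
    rw [Real.norm_of_nonneg (Real.rpow_nonneg hs0.le _)]
    exact Real.rpow_le_rpow_of_nonpos ht.1 hs.1.le (by linarith)
  have h := AntitoneOn.mul_of_nonneg (antitoneOn_rpow (show e - 1 ≤ 0 by linarith))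
    (antitoneOn_tail_average hg hi) (fun t ht => Real.rpow_nonneg ht.1.le _) fun t ht =>
      div_nonneg (setIntegral_nonneg measurableSet_Ioo fun s hs =>
        mul_nonneg (hg0 s ⟨ht.1.trans hs.1, hs.2⟩) (Real.rpow_nonneg (ht.1.trans hs.1).le _))
        (by linarith [ht.2])
  simpa only [mulConv, mul_div_assoc] using h

/-- Equality holds at t = 1, and the difference is monotone because p t^(p-1) ≤ 1 + (p - 1) t^p,
which is weighted AM-GM for 1 and t^p with weights 1/p and (p - 1)/p. -/
theorem rpow_sub_rpow_le {p t : ℝ} (hp : 1 < p) (ht : t ∈ Ioc (0 : ℝ) 1) :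
    (p + 1) * (t - t ^ p) ≤ (p - 1) * (1 - t ^ (p + 1)) := by
  have hmono : MonotoneOn (fun t : ℝ => (p + 1) * (t - t ^ p) + (p - 1) * t ^ (p + 1))
      (Ioc 0 1) := by
    have hd : ∀ t ∈ Ioc (0 : ℝ) 1, HasDerivAt
        (fun t : ℝ => (p + 1) * (t - t ^ p) + (p - 1) * t ^ (p + 1))
        ((p + 1) * (1 - p * t ^ (p - 1)) + (p - 1) * ((p + 1) * t ^ (p + 1 - 1))) t := fun t ht =>
      ((((hasDerivAt_id t).sub (Real.hasDerivAt_rpow_const (Or.inl ht.1.ne'))).const_mul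
        (p + 1)).add ((Real.hasDerivAt_rpow_const (Or.inl ht.1.ne')).const_mul (p - 1)))
    refine monotoneOn_of_hasDerivWithinAt_nonneg (convex_Ioc 0 1)
      (fun t ht => (hd t ht).continuousAt.continuousWithinAt)
      (fun t ht => (hd t (interior_subset ht)).hasDerivWithinAt) fun t ht => ?_
    have ht' := interior_subset ht
    have hp0 : 0 < p := by linarith
    have hy := Real.geom_mean_le_arith_mean2_weighted (w₁ := 1 / p) (w₂ := (p - 1) / p)
      (p₁ := 1) (p₂ := t ^ p) (by positivity) (div_nonneg (by linarith) hp0.le) zero_le_one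
      (Real.rpow_nonneg ht'.1.le _) (by field_simp; ring)
    rw [Real.one_rpow, one_mul, ← Real.rpow_mul ht'.1.le, mul_div_cancel₀ _ hp0.ne'] at hy
    have hy2 : p * t ^ (p - 1) ≤ 1 + (p - 1) * t ^ p := by
      have := mul_le_mul_of_nonneg_left hy hp0.le
      refine this.trans (le_of_eq ?_)
      field_simp
    rw [add_sub_cancel_right]
    nlinarith
  have := hmono ht (right_mem_Ioc.2 one_pos) ht.2
  simp only [Real.one_rpow] at this
  linarith

/-- With t = exp(-2y) the quotient is sinh((2j + 1)y)/sinh y, which increases in y. The derivative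
in t has the sign settled by `rpow_sub_rpow_le` at p = 2j + 1. -/
theorem antitoneOn_rpow_sub_rpow_div {j : ℝ} (hj : 0 < j) :
    AntitoneOn (fun t : ℝ => (t ^ (-j) - t ^ (j + 1)) / (1 - t)) (Ioo 0 1) := by
  have hd : ∀ t ∈ Ioo (0 : ℝ) 1, HasDerivAt (fun t : ℝ => (t ^ (-j) - t ^ (j + 1)) / (1 - t))
      (((-j * t ^ (-j - 1) - (j + 1) * t ^ (j + 1 - 1)) * (1 - t) -
        (t ^ (-j) - t ^ (j + 1)) * (-1)) / (1 - t) ^ 2) t := fun t ht =>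
    ((Real.hasDerivAt_rpow_const (Or.inl ht.1.ne')).sub
      (Real.hasDerivAt_rpow_const (Or.inl ht.1.ne'))).div
      ((hasDerivAt_id t).const_sub 1) (by linarith [ht.2])
  refine antitoneOn_of_hasDerivWithinAt_nonpos (convex_Ioo 0 1)
    (fun t ht => (hd t ht).continuousAt.continuousWithinAt)
    (fun t ht => (hd t (interior_subset ht)).hasDerivWithinAt) fun t ht => ?_
  rw [interior_Ioo] at ht
  refine div_nonpos_of_nonpos_of_nonneg ?_ (sq_nonneg _)
  have hk := rpow_sub_rpow_le (p := 2 * j + 1) (by linarith) ⟨ht.1, ht.2.le⟩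
  have hpos := Real.rpow_pos_of_pos ht.1 (-j - 1)
  have e1 : t ^ (-j) = t ^ (-j - 1) * t := by
    rw [← Real.rpow_add_one ht.1.ne']; ring_nf
  have e2 : t ^ (j + 1) = t ^ (-j - 1) * t ^ (2 * j + 1 + 1) := by
    rw [← Real.rpow_add ht.1]; ring_nf
  have e3 : t ^ (j + 1 - 1) = t ^ (-j - 1) * t ^ (2 * j + 1) := by
    rw [← Real.rpow_add ht.1]; ring_nf
  have e4 : t ^ (2 * j + 1 + 1) = t ^ (2 * j + 1) * t := Real.rpow_add_one ht.1.ne' _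
  rw [e4] at hk
  rw [e1, e2, e3, e4]
  have : (-j * t ^ (-j - 1) - (j + 1) * (t ^ (-j - 1) * t ^ (2 * j + 1))) * (1 - t) -
      (t ^ (-j - 1) * t - t ^ (-j - 1) * (t ^ (2 * j + 1) * t)) * (-1) =
      t ^ (-j - 1) * ((j + 1) * (t - t ^ (2 * j + 1)) - j * (1 - t ^ (2 * j + 1) * t)) := by ring
  rw [this]
  exact mul_nonpos_of_nonneg_of_nonpos hpos.le (by linarith)

/-- For a ≤ 1 + v the integrand s^(a-1-v) is already decreasing. Otherwise the convolution is
t^(v-1)(1 - t^(a-v))/(a - v), and symmetrising the exponents leaves a factor t^((a+v-3)/2), which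
decreases because a + v ≤ 3. -/
theorem antitoneOn_mulConv_rpow_div {a v : ℝ} (ha : 0 < a) (hv : 0 < v) (hv1 : v ≤ 1)
    (hav : a + v ≤ 3) :
    AntitoneOn (fun t => mulConv v (fun s => s ^ (a - 1)) t / (1 - t)) (Ioo 0 1) := by
  rcases le_or_gt a (1 + v) with h | h
  · refine antitoneOn_mulConv_div hv hv1 (integrableOn_rpow_sub_one ha)
      (fun s hs => Real.rpow_nonneg hs.1.le _) ?_
    refine (antitoneOn_rpow (show a - 1 - v ≤ 0 by linarith)).congr fun s hs => ?_
    simp only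
    rw [← Real.rpow_add hs.1]; ring_nf
  · set j := (a - v - 1) / 2 with hj
    have hj0 : 0 < j := by rw [hj]; linarith
    have hp : 0 < a - v := by linarith
    have h1 := AntitoneOn.mul_of_nonneg
      (antitoneOn_rpow (show (a + v - 3) / 2 ≤ 0 by linarith))
      (antitoneOn_rpow_sub_rpow_div hj0) (fun t ht => Real.rpow_nonneg ht.1.le _) fun t ht =>
        div_nonneg (sub_nonneg.2 (Real.rpow_le_rpow_of_exponent_ge ht.1 ht.2.le (by linarith)))
          (by linarith [ht.2])
    have h2 : AntitoneOn (fun t : ℝ => (a - v)⁻¹ * (t ^ ((a + v - 3) / 2) *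
        ((t ^ (-j) - t ^ (j + 1)) / (1 - t)))) (Ioo 0 1) := fun x hx y hy hxy =>
      mul_le_mul_of_nonneg_left (h1 hx hy hxy) (inv_nonneg.2 hp.le)
    refine h2.congr fun t ht => ?_
    have hint : ∫ s in Ioo t 1, s ^ (a - 1) * s ^ (-v) = (1 - t ^ (a - v)) / (a - v) := by
      have e : ∫ s in Ioo t 1, s ^ (a - 1) * s ^ (-v) = ∫ s in Ioo t 1, s ^ (a - v - 1) := by
        refine setIntegral_congr_fun measurableSet_Ioo fun s hs => ?_
        rw [← Real.rpow_add (ht.1.trans hs.1)]; ring_nf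
      rw [e, ← integral_Ioc_eq_integral_Ioo, ← intervalIntegral.integral_of_le ht.2.le,
        integral_rpow (Or.inl (by linarith))]
      simp
    simp only [mulConv]
    rw [hint]
    have e1 : t ^ ((a + v - 3) / 2) * t ^ (-j) = t ^ (v - 1) := by
      rw [← Real.rpow_add ht.1, hj]; ring_nf
    have e2 : t ^ ((a + v - 3) / 2) * t ^ (j + 1) = t ^ (v - 1) * t ^ (a - v) := by
      rw [← Real.rpow_add ht.1, ← Real.rpow_add ht.1, hj]; ring_nf
    rw [← mul_div_assoc, mul_sub, e1, e2]
    field_simp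

/-! ### The density with the prescribed moments -/

section Density

/-- The density on `(0, 1)` with moments `(1 + ξ n) / ((n + a) (n + m) (n + v))`. -/
noncomputable def density (ξ a m v t : ℝ) : ℝ :=
  ξ * mulConv v (fun s => s ^ (a - 1)) t +
    (1 - ξ * m) * mulConv m (mulConv v fun s => s ^ (a - 1)) t

/-- The operator multiplying the `n`-th coefficient by `(1 + ξ n) / ((n + m) (n + v))`. -/
noncomputable def pairAvg (ξ m v : ℝ) (F : ℝ → ℝ) (s : ℝ) : ℝ :=
  ξ * avgOp v F s + (1 - ξ * m) * avgOp v (avgOp m F) s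

variable {ξ a m v : ℝ}

theorem integrableOn_density (ha : 0 < a) (hm : 0 < m) (hv : 0 < v) :
    IntegrableOn (density ξ a m v) (Ioo 0 1) := by
  have h := integrableOn_mulConv hv (integrableOn_rpow_sub_one ha)
  exact (h.const_mul ξ).add ((integrableOn_mulConv hm h).const_mul (1 - ξ * m))

theorem mulConv_rpow_nonneg : ∀ t ∈ Ioo (0 : ℝ) 1, 0 ≤ mulConv v (fun s => s ^ (a - 1)) t :=
  fun _ ht => mulConv_nonneg (fun _ hs => Real.rpow_nonneg hs.1.le _) ht

theorem density_nonneg (hξ : 0 ≤ ξ) (hξm : ξ * m ≤ 1) :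
    ∀ t ∈ Ioo (0 : ℝ) 1, 0 ≤ density ξ a m v t := fun t ht =>
  add_nonneg (mul_nonneg hξ (mulConv_rpow_nonneg t ht))
    (mul_nonneg (sub_nonneg.2 hξm) (mulConv_nonneg mulConv_rpow_nonneg ht))

/-- The splitting 1 + ξn = ξ(n + m) + (1 - ξm) has nonnegative coefficients, so the single and the
double convolution can be treated separately. The inner convolution is itself decreasing, which
gives the hypothesis of `antitoneOn_mulConv_div` for the outer one. -/
theorem antitoneOn_density_div (hξ : 0 ≤ ξ) (hξm : ξ * m ≤ 1) (ha : 0 < a) (hm : 0 < m)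
    (hm1 : m ≤ 1) (hv : 0 < v) (hv1 : v ≤ 1) (hav : a + v ≤ 3) :
    AntitoneOn (fun t => density ξ a m v t / (1 - t)) (Ioo 0 1) := by
  have h1 := antitoneOn_mulConv_rpow_div ha hv hv1 hav
  have hsub : AntitoneOn (fun t : ℝ => 1 - t) (Ioo 0 1) := fun x _ y _ hxy => by
    simp only; linarith
  have h2 : AntitoneOn (mulConv v fun s => s ^ (a - 1)) (Ioo 0 1) := by
    refine (AntitoneOn.mul_of_nonneg h1 hsub (fun t ht => div_nonneg (mulConv_rpow_nonneg t ht)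
      (by linarith [ht.2])) (fun t ht => by linarith [ht.2])).congr fun t ht => ?_
    have : 1 - t ≠ 0 := by linarith [ht.2]
    simp only
    field_simp
  have h3 := antitoneOn_mulConv_div hm hm1
    (integrableOn_mulConv hv (integrableOn_rpow_sub_one ha)) mulConv_rpow_nonneg
    (AntitoneOn.mul_of_nonneg h2 (antitoneOn_rpow (show -m ≤ 0 by linarith)) mulConv_rpow_nonneg
      fun t ht => Real.rpow_nonneg ht.1.le _)
  intro x hx y hy hxy
  simp only [density, add_div, mul_div_assoc]
  exact add_le_add (mul_le_mul_of_nonneg_left (h1 hx hy hxy) hξ)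
    (mul_le_mul_of_nonneg_left (h3 hx hy hxy) (sub_nonneg.2 hξm))

theorem continuousOn_pairAvg (hm : 0 < m) (hv : 0 < v) {F : ℝ → ℝ}
    (hF : ContinuousOn F (Icc 0 1)) : ContinuousOn (pairAvg ξ m v F) (Icc 0 1) :=
  (continuousOn_const.mul (continuousOn_avgOp hv hF)).add
    (continuousOn_const.mul (continuousOn_avgOp hv (continuousOn_avgOp hm hF)))

theorem integral_density_mul (ha : 0 < a) (hm : 0 < m) (hv : 0 < v) {F : ℝ → ℝ}
    (hF : ContinuousOn F (Icc 0 1)) :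
    ∫ t in Ioo (0 : ℝ) 1, density ξ a m v t * F t =
      ∫ s in Ioo (0 : ℝ) 1, s ^ (a - 1) * pairAvg ξ m v F s := by
  have hg := integrableOn_rpow_sub_one ha
  have h1 := integrableOn_mulConv hv hg
  have h2 := integrableOn_mulConv hm h1
  have c1 := continuousOn_avgOp hm hF
  simp only [density, pairAvg, add_mul, mul_add, mul_assoc, mul_left_comm (_ ^ (a - 1))]
  rw [integral_add ((h1.mul_continuousOn_Ioo hF).const_mul ξ)
      ((h2.mul_continuousOn_Ioo hF).const_mul _),
    integral_add ((hg.mul_continuousOn_Ioo (continuousOn_avgOp hv hF)).const_mul ξ)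
      ((hg.mul_continuousOn_Ioo (continuousOn_avgOp hv c1)).const_mul _)]
  simp only [integral_const_mul]
  rw [integral_mulConv_mul hv hg hF, integral_mulConv_mul hm h1 hF, integral_mulConv_mul hv hg c1]

theorem HasSeriesOn.pairAvg (hm : 0 < m) (hv : 0 < v) {s : ℝ} (hs : 0 ≤ s)
    {c : ℕ → ℝ} {F : ℝ → ℝ} (h : HasSeriesOn s c F) :
    HasSeriesOn s (fun n : ℕ => (1 + ξ * n) / ((n + m) * (n + v)) * c n) (pairAvg ξ m v F) := by
  have h1 := h.avgOp hs hv
  have h2 := (h.avgOp hs hm).avgOp hs hv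
  have e : ∀ n : ℕ, (1 + ξ * n) / ((n + m) * (n + v)) * c n =
      ξ * (((n : ℝ) + v)⁻¹ • c n) + (1 - ξ * m) * (((n : ℝ) + v)⁻¹ • ((n : ℝ) + m)⁻¹ • c n) := by
    intro n
    have : (n : ℝ) + v ≠ 0 := by positivity
    have : (n : ℝ) + m ≠ 0 := by positivity
    simp only [smul_eq_mul]
    field_simp
    ring
  constructor
  · refine ((h1.1.mul_left |ξ|).add (h2.1.mul_left |1 - ξ * m|)).of_nonneg_of_le
      (fun n => by positivity) fun n => ?_
    beta_reduce
    rw [e, ← mul_assoc, ← mul_assoc, ← add_mul]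
    refine mul_le_mul_of_nonneg_right ?_ (by positivity)
    refine (norm_add_le _ _).trans (le_of_eq ?_)
    rw [norm_mul, norm_mul, Real.norm_eq_abs ξ, Real.norm_eq_abs (1 - ξ * m)]
  · intro x hx
    refine (((h1.2 x hx).mul_left ξ).add ((h2.2 x hx).mul_left (1 - ξ * m))).congr_fun fun n => ?_
    beta_reduce
    rw [e]
    simp only [smul_eq_mul]
    ring

theorem hasSum_integral_density_mul (ha : 0 < a) (hm : 0 < m) (hv : 0 < v) {c : ℕ → ℝ} {F : ℝ → ℝ}
    (hF : ContinuousOn F (Icc 0 1)) (h : HasSeriesOn 1 c F) :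
    HasSum (fun n : ℕ => (1 + ξ * n) / ((n + a) * (n + m) * (n + v)) * c n)
      (∫ t in Ioo (0 : ℝ) 1, density ξ a m v t * F t) := by
  rw [integral_density_mul ha hm hv hF]
  have h1 := (h.pairAvg (ξ := ξ) hm hv zero_le_one).hasSum_avgOp zero_le_one ha
  simp only [avgOp, one_mul, smul_eq_mul] at h1
  refine h1.congr_fun fun n => ?_
  have : (n : ℝ) + v ≠ 0 := by positivity
  have : (n : ℝ) + m ≠ 0 := by positivity
  have : (n : ℝ) + a ≠ 0 := by positivity
  simp only [one_pow, one_mul]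
  field_simp

end Density

/-! ### Power series of the two kernels -/

section Series

theorem hasSum_one_add_mul_geometric {ζ : ℂ} (hζ : ‖ζ‖ < 1) (w : ℂ) :
    HasSum (fun n : ℕ => (1 + n * w) * ζ ^ n) ((1 + (w - 1) * ζ) / (1 - ζ) ^ 2) := by
  have hne : 1 - ζ ≠ 0 := by
    intro h
    have : ζ = 1 := by linear_combination -h
    rw [this, norm_one] at hζ
    exact lt_irrefl _ hζ
  have h := (hasSum_geometric_of_norm_lt_one hζ).add
    ((hasSum_coe_mul_geometric_of_norm_lt_one hζ).mul_left w)
  have e : (1 + (w - 1) * ζ) / (1 - ζ) ^ 2 = (1 - ζ)⁻¹ + w * (ζ / (1 - ζ) ^ 2) := by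
    field_simp; ring
  rw [e]
  exact h.congr_fun fun n => by ring

theorem summable_add_one_mul_pow {r : ℝ} (hr : 0 ≤ r) (hr1 : r < 1) :
    Summable fun n : ℕ => ((n : ℝ) + 1) * r ^ n := by
  have hn : ‖r‖ < 1 := by rwa [Real.norm_of_nonneg hr]
  have h1 := summable_pow_mul_geometric_of_norm_lt_one 1 hn
  have h2 := summable_geometric_of_lt_one hr hr1
  simpa [add_mul] using h1.add h2

theorem norm_le_one_of_norm_sub_half_le {w : ℂ} (hw : ‖w - 1 / 2‖ ≤ 1 / 2) : ‖w‖ ≤ 1 := by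
  have := norm_le_norm_add_norm_sub' w (1 / 2)
  have h2 : ‖(1 / 2 : ℂ)‖ = 1 / 2 := by norm_num
  linarith

theorem norm_one_add_natCast_mul_le {w : ℂ} (hw : ‖w - 1 / 2‖ ≤ 1 / 2) (n : ℕ) :
    ‖1 + n * w‖ ≤ (n : ℝ) + 1 := by
  refine (norm_add_le _ _).trans ?_
  rw [norm_one, norm_mul, Complex.norm_natCast]
  nlinarith [norm_le_one_of_norm_sub_half_le hw, (Nat.cast_nonneg n : (0 : ℝ) ≤ n)]

theorem hasSeriesOn_re_kernel {z w : ℂ} (hz : ‖z‖ < 1) (hw : ‖w - 1 / 2‖ ≤ 1 / 2) :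
    HasSeriesOn 1 (fun n : ℕ => ((1 + n * w) * z ^ n).re)
      (fun t : ℝ => ((1 + (w - 1) * (t * z)) / (1 - t * z) ^ 2).re) := by
  constructor
  · refine (summable_add_one_mul_pow (norm_nonneg z) hz).of_nonneg_of_le
      (fun n => by positivity) fun n => ?_
    rw [one_pow, mul_one, Real.norm_eq_abs]
    refine (Complex.abs_re_le_norm _).trans ?_
    rw [norm_mul, norm_pow]
    exact mul_le_mul_of_nonneg_right (norm_one_add_natCast_mul_le hw n) (by positivity)
  · intro x hx
    have hxz : ‖(x : ℂ) * z‖ < 1 := by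
      rw [norm_mul, Complex.norm_real, Real.norm_of_nonneg hx.1]
      nlinarith [hx.1, hx.2, norm_nonneg z]
    have h := (Complex.hasSum_iff _ _).1 (hasSum_one_add_mul_geometric hxz w)
    refine h.1.congr_fun fun n => ?_
    rw [mul_pow, mul_left_comm, ← Complex.ofReal_pow, Complex.re_ofReal_mul, smul_eq_mul]

theorem hasSeriesOn_one_div_one_add_sq {s : ℝ} (hs : 0 ≤ s) (hs1 : s < 1) :
    HasSeriesOn s (fun n : ℕ => ((n : ℝ) + 1) * (-1) ^ n) (fun t => 1 / (1 + t) ^ 2) := by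
  constructor
  · refine (summable_add_one_mul_pow hs hs1).congr fun n => ?_
    rw [norm_mul, norm_pow, norm_neg, norm_one, one_pow, mul_one,
      Real.norm_of_nonneg (by positivity)]
  · intro x hx
    have hx1 : ‖-x‖ < 1 := by
      rw [norm_neg, Real.norm_of_nonneg hx.1]; exact hx.2.trans_lt hs1
    have h := (hasSum_geometric_of_norm_lt_one hx1).add
      (hasSum_coe_mul_geometric_of_norm_lt_one hx1)
    have e : 1 / (1 + x) ^ 2 = (1 - -x)⁻¹ + -x / (1 - -x) ^ 2 := by
      have : 1 + x ≠ 0 := by have := hx.1; positivity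
      rw [sub_neg_eq_add]
      field_simp; ring
    beta_reduce
    rw [e]
    refine h.congr_fun fun n => ?_
    rw [neg_pow, smul_eq_mul]; ring

end Series

/-! ### The condition relating β and ρ -/

section Condition

variable {μ ν : ℝ}

theorem summable_aux_series (hμ : 0 ≤ μ) (hν : 0 ≤ ν) {t : ℝ} (ht : t ∈ Ioo (0 : ℝ) 1) (k : ℕ) :
    Summable fun n : ℕ => ((n : ℝ) + 1) ^ k * (-1) ^ n * t ^ n / ((1 + μ * n) * (1 + ν * n)) := by
  have hn : ‖t‖ < 1 := by rw [Real.norm_of_nonneg ht.1.le]; exact ht.2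
  have h1 : Summable fun n : ℕ => ((n : ℝ) + 1) ^ k * t ^ n := by
    have h := (summable_nat_add_iff (f := fun n : ℕ => (n : ℝ) ^ k * t ^ n) 1).2
      (summable_pow_mul_geometric_of_norm_lt_one k hn)
    refine (h.mul_right t⁻¹).congr fun n => ?_
    have := ht.1.ne'
    push_cast
    rw [pow_succ]
    field_simp
  refine Summable.of_norm_bounded h1 fun n => ?_
  have hD : 1 ≤ (1 + μ * n) * (1 + ν * n) := by
    have h2 := mul_nonneg hμ (Nat.cast_nonneg (α := ℝ) n)
    have h3 := mul_nonneg hν (Nat.cast_nonneg (α := ℝ) n)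
    nlinarith [mul_nonneg h2 h3]
  have ht0 := ht.1.le
  rw [norm_div, norm_mul, norm_mul, norm_pow, norm_pow, norm_pow, norm_neg, norm_one, one_pow,
    mul_one, Real.norm_of_nonneg ht0, Real.norm_of_nonneg (by positivity : (0 : ℝ) ≤ (n : ℝ) + 1),
    Real.norm_of_nonneg (by linarith)]
  exact div_le_self (by positivity) hD

/-- Termwise, (1 - ξ)(n + 1) + ξ(n + 1)² = (n + 1)(1 + ξn), and Σ (n + 1)(-t)ⁿ = 1/(1 + t)². The
comparison stays at t < 1, where the series converge absolutely. -/
theorem bracket_eq_pairAvg (hμ : 0 < μ) (hν : 0 < ν) (ξ : ℝ) {t : ℝ} (ht : t ∈ Ioo (0 : ℝ) 1) :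
    (1 - ξ) * ((1 - gAux μ ν t) / 2) + ξ * (1 - qAux μ ν t) =
      1 - μ⁻¹ * ν⁻¹ * pairAvg ξ μ⁻¹ ν⁻¹ (fun t => 1 / (1 + t) ^ 2) t := by
  have h1 : HasSum (fun n : ℕ => ((n : ℝ) + 1) * (-1) ^ n * t ^ n / ((1 + μ * n) * (1 + ν * n)))
      (∑' n : ℕ, ((n : ℝ) + 1) * (-1) ^ n * t ^ n / ((1 + μ * n) * (1 + ν * n))) := by
    have := (summable_aux_series hμ.le hν.le ht 1).hasSum
    simpa only [pow_one] using this
  have h2 := (summable_aux_series hμ.le hν.le ht 2).hasSum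
  have h3 := ((hasSeriesOn_one_div_one_add_sq ht.1.le ht.2).pairAvg (ξ := ξ) (inv_pos.2 hμ)
    (inv_pos.2 hν) ht.1.le).2 t ⟨ht.1.le, le_rfl⟩
  have h4 := ((h1.mul_left (1 - ξ)).add (h2.mul_left ξ)).unique
    ((h3.mul_left (μ⁻¹ * ν⁻¹)).congr_fun fun n => ?_)
  · rw [← h4, gAux, qAux]; ring
  · have : 1 + μ * n ≠ 0 := by positivity
    have : 1 + ν * n ≠ 0 := by positivity
    have e1 : (n : ℝ) + μ⁻¹ = (1 + μ * n) / μ := by field_simp; ring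
    have e2 : (n : ℝ) + ν⁻¹ = (1 + ν * n) / ν := by field_simp; ring
    beta_reduce
    rw [e1, e2, smul_eq_mul]
    field_simp
    ring

theorem integral_bernardiWeight_mul (hμ : 0 < μ) (hν : 0 < ν) (ξ : ℝ) {c : ℝ} (hc : -1 < c) :
    ∫ t in (0 : ℝ)..1, bernardiWeight c t *
      ((1 - ξ) * ((1 - gAux μ ν t) / 2) + ξ * (1 - qAux μ ν t)) =
    1 - (c + 1) * μ⁻¹ * ν⁻¹ *
      ∫ t in Ioo (0 : ℝ) 1, density ξ (c + 1) μ⁻¹ ν⁻¹ t * (1 / (1 + t) ^ 2) := by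
  have ha : 0 < c + 1 := by linarith
  have hm := inv_pos.2 hμ
  have hv := inv_pos.2 hν
  have hg := integrableOn_rpow_sub_one ha
  have hP := hg.mul_continuousOn_Ioo
    (continuousOn_pairAvg (ξ := ξ) hm hv continuousOn_one_div_one_add_sq)
  rw [intervalIntegral.integral_of_le zero_le_one, integral_Ioc_eq_integral_Ioo,
    integral_density_mul ha hm hv continuousOn_one_div_one_add_sq, ← integral_const_mul]
  have e : ∫ t in Ioo (0 : ℝ) 1, bernardiWeight c t *
      ((1 - ξ) * ((1 - gAux μ ν t) / 2) + ξ * (1 - qAux μ ν t)) =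
      ∫ t in Ioo (0 : ℝ) 1, ((c + 1) * t ^ (c + 1 - 1) - (c + 1) * μ⁻¹ * ν⁻¹ *
        (t ^ (c + 1 - 1) * pairAvg ξ μ⁻¹ ν⁻¹ (fun t => 1 / (1 + t) ^ 2) t)) := by
    refine setIntegral_congr_fun measurableSet_Ioo fun t ht => ?_
    rw [bracket_eq_pairAvg hμ hν ξ ht, bernardiWeight, add_sub_cancel_right]
    ring
  rw [e, integral_sub (hg.const_mul _) (hP.const_mul _), integral_const_mul,
    integral_rpow_sub_one ha, mul_inv_cancel₀ ha.ne']

end Condition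

/-! ### Coefficients of the operator and of the class W -/

theorem HasDiscSeries.const (k : ℂ) :
    HasDiscSeries (fun n => if n = 0 then k else 0) (fun _ => k) := by
  intro z _
  have := hasSum_single (f := fun n : ℕ => (if n = 0 then k else 0) * z ^ n) 0
    (by intro n hn; simp [hn])
  simpa using this

theorem HasDiscSeries.mul_bounded {a : ℕ → ℂ} {F : ℂ → ℂ} (h : HasDiscSeries a F) {κ : ℕ → ℂ}
    {C : ℝ} (hκ : ∀ n, ‖κ n‖ ≤ C) :
    HasDiscSeries (fun n => κ n * a n) (fun z => ∑' n, κ n * a n * z ^ n) := by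
  refine HasDiscSeries.of_summable fun z hz => ?_
  refine Summable.of_norm_bounded
    ((h.summable_norm (norm_nonneg z) (by simpa using hz)).mul_left C) fun n => ?_
  rw [norm_mul, norm_mul, norm_pow, mul_assoc]
  exact mul_le_mul_of_nonneg_right (hκ n) (by positivity)

/-- The Taylor coefficients of `operatorKernel (bernardiWeight c) ρ`, divided by `z`. -/
noncomputable def kernelCoeff (c ρ : ℝ) (n : ℕ) : ℂ :=
  (((c + 1) * ((n : ℝ) + (c + 1))⁻¹ * (if n = 0 then 1 else 1 - ρ) : ℝ) : ℂ)

theorem kernelCoeff_zero {c : ℝ} (hc : -1 < c) (ρ : ℝ) : kernelCoeff c ρ 0 = 1 := by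
  have : c + 1 ≠ 0 := by linarith
  simp [kernelCoeff, this]

theorem norm_kernelCoeff_le {c ρ : ℝ} (hc : -1 < c) (hρ : ρ < 1) (n : ℕ) :
    ‖kernelCoeff c ρ n‖ ≤ 1 + (1 - ρ) := by
  have ha : 0 < c + 1 := by linarith
  have h1 : (c + 1) * ((n : ℝ) + (c + 1))⁻¹ ≤ 1 := by
    rw [← div_eq_mul_inv, div_le_one (by positivity)]
    linarith [(Nat.cast_nonneg n : (0 : ℝ) ≤ n)]
  have h2 : (0 : ℝ) ≤ (if n = 0 then 1 else 1 - ρ) ∧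
      (if n = 0 then 1 else 1 - ρ) ≤ 1 + (1 - ρ) := by
    split_ifs <;> constructor <;> linarith
  rw [kernelCoeff, Complex.norm_real, Real.norm_of_nonneg (mul_nonneg (by positivity) h2.1)]
  exact (mul_le_of_le_one_left h2.1 h1).trans h2.2

theorem hasDiscSeries_operatorKernel {c : ℝ} (hc : -1 < c) (ρ : ℝ) :
    HasDiscSeries (fun n => Nat.casesOn n 0 (kernelCoeff c ρ))
      (operatorKernel (bernardiWeight c) ρ) := by
  have ha : 0 < c + 1 := by linarith
  refine HasDiscSeries.id_mul fun z hz => ?_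
  have hz1 : ‖z‖ < 1 := by simpa using hz
  have hser : HasSeriesOn 1 (fun n => ((if n = 0 then 1 else 1 - ρ : ℝ) : ℂ) * z ^ n)
      (fun t : ℝ => (1 - ρ * t * z) / (1 - t * z)) := by
    constructor
    · refine ((summable_geometric_of_lt_one (norm_nonneg z) hz1).mul_left
        (1 + |1 - ρ|)).of_nonneg_of_le (fun n => by positivity) fun n => ?_
      rw [one_pow, mul_one, norm_mul, norm_pow, Complex.norm_real]
      refine mul_le_mul_of_nonneg_right ?_ (by positivity)
      split_ifs
      · rw [norm_one]; linarith [abs_nonneg (1 - ρ)]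
      · rw [Real.norm_eq_abs]; linarith
    · intro x hx
      have hxz : ‖(x : ℂ) * z‖ < 1 := by
        rw [norm_mul, Complex.norm_real, Real.norm_of_nonneg hx.1]
        nlinarith [hx.1, hx.2, norm_nonneg z]
      have hne : 1 - (x : ℂ) * z ≠ 0 := by
        intro h
        have : (x : ℂ) * z = 1 := by linear_combination -h
        rw [this, norm_one] at hxz
        exact lt_irrefl _ hxz
      have h := ((hasSum_geometric_of_norm_lt_one hxz).mul_left (1 - ρ : ℂ)).add
        (HasDiscSeries.const (ρ : ℂ) ((x : ℂ) * z) (by simpa using hxz))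
      -- The added constant ρ raises the zeroth coefficient from 1 - ρ to 1, hence the case split in
      -- `kernelCoeff`.
      have e : (1 - ρ * x * z) / (1 - x * z) = (1 - ρ : ℂ) * (1 - x * z)⁻¹ + ρ := by
        field_simp; ring
      beta_reduce
      rw [e]
      refine h.congr_fun fun n => ?_
      by_cases hn : n = 0
      · simp [hn]
      · simp only [hn, if_false, Complex.real_smul, mul_pow]
        push_cast; ring
  have h := (hser.hasSum_avgOp zero_le_one ha).mul_left ((c + 1 : ℝ) : ℂ)
  have e : ∫ t in (0 : ℝ)..1, (bernardiWeight c t : ℂ) * ((1 - ρ * t * z) / (1 - t * z)) =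
      ((c + 1 : ℝ) : ℂ) * avgOp (c + 1) (fun t : ℝ => (1 - ρ * t * z) / (1 - t * z)) 1 := by
    rw [intervalIntegral.integral_of_le zero_le_one, integral_Ioc_eq_integral_Ioo, avgOp,
      ← integral_const_mul]
    refine setIntegral_congr_fun measurableSet_Ioo fun t ht => ?_
    simp only [bernardiWeight, add_sub_cancel_right, one_mul, Complex.real_smul]
    push_cast; ring
  rw [e]
  refine h.congr_fun fun n => ?_
  simp only [kernelCoeff, one_pow, one_smul, Complex.real_smul]
  push_cast; ring

/-- Nonvanishing of `D + w (N - D)` on the disc with diameter `[0, 1]` means `Re (N / D) > 0`. -/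
theorem re_div_pos_of_forall_ne_zero {N D : ℂ}
    (h : ∀ w : ℂ, ‖w - 1 / 2‖ ≤ 1 / 2 → D + w * (N - D) ≠ 0) : 0 < (N / D).re := by
  -- The choice w = 0 excludes a zero denominator.
  have hD : D ≠ 0 := by simpa using h 0 (by norm_num)
  by_contra hcon
  set u := N / D with hu
  have hN : N = u * D := by rw [hu, div_mul_cancel₀ _ hD]
  have hre : u.re ≤ 0 := not_lt.1 hcon
  have hne : 1 - u ≠ 0 := by
    intro h0
    have : u = 1 := by linear_combination -h0
    rw [this, Complex.one_re] at hre
    linarith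
  -- This w solves 1 + w(u - 1) = 0; it lies in the disc because Re u ≤ 0 gives |1 + u| ≤ |1 - u|.
  refine h (1 / (1 - u)) ?_ (by rw [hN]; field_simp; ring)
  have e : 1 / (1 - u) - 1 / 2 = (1 + u) / (2 * (1 - u)) := by field_simp; ring
  rw [e, norm_div, norm_mul, Complex.norm_ofNat, div_le_iff₀ (by positivity)]
  have hsq : ‖1 + u‖ ^ 2 ≤ ‖1 - u‖ ^ 2 := by
    rw [← Complex.normSq_eq_norm_sq, ← Complex.normSq_eq_norm_sq, Complex.normSq_apply,
      Complex.normSq_apply]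
    simp
    nlinarith
  have := abs_le_of_sq_le_sq hsq (norm_nonneg _)
  linarith [this, le_abs_self ‖1 + u‖]

/-- The coefficient identity is (1 - α + 2γ) + (α - 2γ)(n + 1) + γn(n + 1) = 1 + (α - γ)n + γn² = (1
+ μn)(1 + νn). -/
theorem hasDiscSeries_classW {f : ℂ → ℂ} (hf : f ∈ classA) {α γ μ ν β : ℝ} (hsum : μ + ν = α - γ)
    (hprod : μ * ν = γ) (κ : ℂ) :
    HasDiscSeries (fun n => κ * ((1 + μ * n) * (1 + ν * n) * taylorCoeff f (n + 1) -
        if n = 0 then (β : ℂ) else 0))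
      (fun z => κ * ((1 - α + 2 * γ) * dslope f 0 z + (α - 2 * γ) * deriv f z
        + γ * z * deriv (deriv f) z - β)) := by
  have h := HasDiscSeries.of_differentiableOn hf.1
  refine ((((((h.dslope_zero hf.2.1).const_mul (1 - α + 2 * γ)).add
    (h.deriv.const_mul (α - 2 * γ))).add (h.deriv.id_mul_deriv.const_mul γ)).add
    (HasDiscSeries.const (-β))).const_mul κ).congr (fun n => ?_) (fun z _ => by ring)
  have hα : (α : ℂ) = μ + ν + μ * ν := by
    rw [← hprod] at hsum
    have : α = μ + ν + μ * ν := by linarith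
    rw [this]; push_cast; ring
  have hγ : (γ : ℂ) = μ * ν := by rw [← hprod]; push_cast; ring
  rw [hα, hγ]
  split_ifs with hn <;> ring

/-! ### The multiplier kernel and its real part -/

section MultiplierKernel

variable {ξ a m v : ℝ}

theorem coeff_le (hξm : ξ * m ≤ 1) (ha : 0 < a) (hm : 0 < m) (hv : 0 < v) (n : ℕ) :
    (1 + ξ * n) / ((n + a) * (n + m) * (n + v)) ≤ 1 / (a * m * v) := by
  have hn : (0 : ℝ) ≤ n := Nat.cast_nonneg n
  rw [div_le_div_iff₀ (by positivity) (by positivity), one_mul]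
  have h1 : (1 + ξ * n) * m ≤ n + m := by nlinarith
  have h2 : a * v ≤ (n + a) * (n + v) := by nlinarith [mul_nonneg hn ha.le, mul_nonneg hn hv.le]
  calc (1 + ξ * n) * (a * m * v) = ((1 + ξ * n) * m) * (a * v) := by ring
    _ ≤ (n + m) * ((n + a) * (n + v)) := by gcongr
    _ = _ := by ring

theorem hasDiscSeries_multiplier (hξ : 0 ≤ ξ) (hξm : ξ * m ≤ 1) (ha : 0 < a) (hm : 0 < m)
    (hv : 0 < v) (w : ℂ) :
    HasDiscSeries (fun n => (((1 + ξ * n) / ((n + a) * (n + m) * (n + v)) : ℝ) : ℂ) * (1 + n * w))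
      (fun z => ∑' n : ℕ, (((1 + ξ * n) / ((n + a) * (n + m) * (n + v)) : ℝ) : ℂ) * (1 + n * w)
        * z ^ n) := by
  refine HasDiscSeries.mul_bounded (F := fun z => (1 + (w - 1) * z) / (1 - z) ^ 2)
    (fun z hz => hasSum_one_add_mul_geometric (by simpa using hz) w) (C := 1 / (a * m * v))
    fun n => ?_
  rw [Complex.norm_real, Real.norm_of_nonneg (by positivity)]
  exact coeff_le hξm ha hm hv n

theorem re_multiplier_eq (hξ : 0 ≤ ξ) (hξm : ξ * m ≤ 1) (ha : 0 < a) (hm : 0 < m)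
    (hv : 0 < v) {z w : ℂ} (hz : ‖z‖ < 1) (hw : ‖w - 1 / 2‖ ≤ 1 / 2) :
    (∑' n : ℕ, (((1 + ξ * n) / ((n + a) * (n + m) * (n + v)) : ℝ) : ℂ) * (1 + n * w)
        * z ^ n).re = ∫ t in Ioo (0 : ℝ) 1, density ξ a m v t *
      ((1 + (w - 1) * (t * z)) / (1 - t * z) ^ 2).re := by
  have h1 := (Complex.hasSum_iff _ _).1
    (hasDiscSeries_multiplier hξ hξm ha hm hv w z (by simpa using hz))
  refine h1.1.unique ((hasSum_integral_density_mul ha hm hv (continuousOn_re_kernel hz w)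
    (hasSeriesOn_re_kernel hz hw)).congr_fun fun n => ?_)
  rw [mul_assoc, Complex.re_ofReal_mul]

theorem integral_density_le_re_multiplier (hξ : 0 ≤ ξ) (hξm : ξ * m ≤ 1) (ha : 0 < a) (hm : 0 < m)
    (hm1 : m ≤ 1) (hv : 0 < v) (hv1 : v ≤ 1) (hav : a + v ≤ 3) {z w : ℂ} (hz : ‖z‖ < 1)
    (hw : ‖w - 1 / 2‖ ≤ 1 / 2) :
    ∫ t in Ioo (0 : ℝ) 1, density ξ a m v t * (1 / (1 + t) ^ 2) ≤
      (∑' n : ℕ, (((1 + ξ * n) / ((n + a) * (n + m) * (n + v)) : ℝ) : ℂ) * (1 + n * w)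
        * z ^ n).re := by
  have hi := integrableOn_density (ξ := ξ) ha hm hv
  rw [re_multiplier_eq hξ hξm ha hm hv hz hw, ← sub_nonneg,
    ← integral_sub (hi.mul_continuousOn_Ioo (continuousOn_re_kernel hz w))
      (hi.mul_continuousOn_Ioo continuousOn_one_div_one_add_sq)]
  simp only [← mul_sub]
  exact integral_mul_re_kernel_nonneg hi (density_nonneg hξ hξm)
    (antitoneOn_density_div hξ hξm ha hm hm1 hv hv1 hav) hz hw

end MultiplierKernel

end PascuClass

/-! ### Proof of the theorem -/

open PascuClass in
theorem mainTheorem10 (α γ μ ν ξ ρ β c : ℝ)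
    (hξ₀ : 0 ≤ ξ) (hξ₁ : ξ ≤ 1) (hμ : 1 < μ) (hν : 1 < ν)
    (hsum : μ + ν = α - γ) (hprod : μ * ν = γ)
    (hρ : ρ < 1) (hβ : β < 1)
    (hβρ : 1 / (2 * (1 - β) * (1 - ρ)) =
      ∫ t in (0 : ℝ)..1, PascuClass.bernardiWeight c t *
        ((1 - ξ) * ((1 - PascuClass.gAux μ ν t) / 2) + ξ * (1 - PascuClass.qAux μ ν t)))
    (hc₀ : -1 < c)
    (hc₁ : c ≤ min (1 + 1 / μ - 1 / ν) ((1 + 1 / μ - ξ) / (1 + 2 * ξ))) :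
    ∀ f ∈ PascuClass.classW β α γ,
      PascuClass.generalizedOperator (PascuClass.bernardiWeight c) ρ f ∈ PascuClass.classM ξ := by
  rintro f ⟨hfA, φ, hφ⟩
  have hμ0 : 0 < μ := by linarith
  have hν0 : 0 < ν := by linarith
  have hm := inv_pos.2 hμ0
  have hv := inv_pos.2 hν0
  have hm1 : μ⁻¹ ≤ 1 := inv_le_one_of_one_le₀ hμ.le
  have hv1 : ν⁻¹ ≤ 1 := inv_le_one_of_one_le₀ hν.le
  have ha : 0 < c + 1 := by linarith
  have hξm : ξ * μ⁻¹ ≤ 1 := mul_le_one₀ hξ₁ hm.le hm1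
  have hav : c + 1 + ν⁻¹ ≤ 3 := by
    have := hc₁.trans (min_le_left _ _)
    rw [one_div, one_div] at this
    linarith
  have hf := HasDiscSeries.of_differentiableOn hfA.1
  set A := taylorCoeff f with hA
  have hA0 : A 0 = 0 := by simp [hA, taylorCoeff, hfA.2.1]
  have hA1 : A 1 = 1 := by simp [hA, taylorCoeff, hfA.2.2]
  set κ : ℕ → ℂ := fun n => Nat.casesOn n 0 (kernelCoeff c ρ) with hκ
  set V := generalizedOperator (bernardiWeight c) ρ f with hVdef
  have hV : HasDiscSeries (fun n => κ n * A n) V := by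
    have hb : ∀ n, ‖κ n‖ ≤ 1 + (1 - ρ) := by
      intro n
      cases n with
      | zero =>
        change ‖(0 : ℂ)‖ ≤ _
        rw [norm_zero]; linarith
      | succ n => exact norm_kernelCoeff_le hc₀ hρ n
    refine (hf.mul_bounded hb).congr (fun _ => rfl) fun z _ => ?_
    simp only [hVdef, generalizedOperator, hadamard,
      (hasDiscSeries_operatorKernel hc₀ ρ).taylorCoeff_eq]
    rfl
  have hVA : V ∈ classA := by
    refine ⟨hV.differentiableOn, ?_, ?_⟩
    · have := hV.taylorCoeff_eq 0
      simpa [taylorCoeff, hA0] using this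
    · have := hV.taylorCoeff_eq 1
      simpa [taylorCoeff, hA1, hκ, kernelCoeff_zero hc₀] using this
  refine ⟨hVA, fun z hz hz0 => re_div_pos_of_forall_ne_zero fun w hw => ?_⟩
  have hD := (hV.id_mul_deriv.const_mul ξ).add (hV.const_mul (1 - ξ))
  have hN := (hV.id_mul_deriv.id_mul_deriv.const_mul ξ).add (hV.id_mul_deriv.const_mul (1 - ξ))
  set D := (ξ : ℂ) * (z * deriv V z) + (1 - ξ) * V z
  set N := (ξ : ℂ) * (z * deriv (fun w => w * deriv V w) z) + (1 - ξ) * (z * deriv V z)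
  have hDz : HasSum (fun n : ℕ => (ξ * (n * (κ n * A n)) + (1 - ξ) * (κ n * A n)) * z ^ n) D :=
    hD z hz
  have hNz : HasSum (fun n : ℕ => (ξ * (n * (n * (κ n * A n))) + (1 - ξ) * (n * (κ n * A n)))
      * z ^ n) N := hN z hz
  have hcomb := hDz.add ((hNz.sub hDz).mul_left w)
  -- The zeroth coefficient vanishes, so the shift prepares division by z; the coefficient at n + 1
  -- is then (1 + ξn)(1 + nw) times that of `V`.
  rw [← hasSum_nat_add_iff' 1] at hcomb
  simp only [Finset.range_one, Finset.sum_singleton, hA0, mul_zero, zero_mul, add_zero, sub_zero,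
    CharP.cast_eq_zero] at hcomb
  set M : ℝ := (1 - ρ) * (1 - β) * ((c + 1) * μ⁻¹ * ν⁻¹) with hM
  have hρ' : 0 < 1 - ρ := by linarith
  have hβ' : 0 < 1 - β := by linarith
  have hM0 : 0 < M := by positivity
  have hB := hasDiscSeries_multiplier hξ₀ hξm ha hm hv w
  -- M times the zeroth multiplier coefficient is (1 - ρ)(1 - β); the added constant normalises K(0)
  -- to 1.
  have hK := (hB.const_mul M).add (HasDiscSeries.const (1 - (1 - ρ) * (1 - β) : ℂ))
  have hQ := hasDiscSeries_classW (β := β) hfA hsum hprod (Complex.exp (φ * Complex.I))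
  have hc0 : (c : ℂ) + 1 ≠ 0 := by exact_mod_cast ha.ne'
  have hμC : (μ : ℂ) ≠ 0 := by exact_mod_cast hμ0.ne'
  have hνC : (ν : ℂ) ≠ 0 := by exact_mod_cast hν0.ne'
  have hpos := HasDiscSeries.re_convolution_pos hQ hK ?_ hφ (fun x hx => ?_) hz
    -- The factor 1 - β matches the zeroth coefficient of the W function, from which β is
    -- subtracted.
    (s := Complex.exp (φ * Complex.I) * (1 - β) * ((D + w * (N - D)) * z⁻¹))
    (((hcomb.mul_right z⁻¹).mul_left (Complex.exp (φ * Complex.I) * (1 - β))).congr_fun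
      fun n => ?_)
  · intro h0
    rw [h0] at hpos
    simp at hpos
  · simp only [hM, if_true, CharP.cast_eq_zero, zero_add, zero_mul, mul_zero, add_zero]
    push_cast
    field_simp
    ring
  · have hL := integral_bernardiWeight_mul hμ0 hν0 ξ hc₀
    rw [← hβρ] at hL
    have hX := integral_density_le_re_multiplier hξ₀ hξm ha hm hm1 hv hv1 hav
      (show ‖x‖ < 1 by simpa using hx) hw
    set X := ∫ t in Ioo (0 : ℝ) 1, density ξ (c + 1) μ⁻¹ ν⁻¹ t * (1 / (1 + t) ^ 2)
    -- The hypothesis on β and ρ makes the extremal value M X equal to (1 - ρ)(1 - β) - 1/2, so the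
    -- added constant brings the lower bound to exactly 1/2.
    have h1 : M * X = (1 - ρ) * (1 - β) - 1 / 2 := by
      have : M * X = (1 - ρ) * (1 - β) * (1 - 1 / (2 * (1 - β) * (1 - ρ))) := by
        rw [hL, hM]; ring
      rw [this]
      field_simp
    have h2 := mul_le_mul_of_nonneg_left hX hM0.le
    rw [Complex.add_re, Complex.re_ofReal_mul]
    have h3 : (1 - (1 - ρ) * (1 - β) : ℂ).re = 1 - (1 - ρ) * (1 - β) := by
      have : (1 - (1 - ρ) * (1 - β) : ℂ) = ((1 - (1 - ρ) * (1 - β) : ℝ) : ℂ) := by push_cast; rfl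
      rw [this, Complex.ofReal_re]
    rw [h3]
    linarith
  · have hzn : z ^ (n + 1) * z⁻¹ = z ^ n := by rw [pow_succ]; field_simp
    by_cases hn : n = 0
    · subst hn
      simp [← hA, hA1, hκ, kernelCoeff_zero hc₀, hM]
      left
      field_simp
      ring
    · have e1 : ((n : ℂ) + (c + 1)) ≠ 0 := by
        have : (0 : ℝ) < (n : ℝ) + (c + 1) := by positivity
        exact_mod_cast this.ne'
      have e2 : (n : ℂ) + (μ : ℂ)⁻¹ ≠ 0 := by
        have : (0 : ℝ) < (n : ℝ) + μ⁻¹ := by positivity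
        exact_mod_cast this.ne'
      have e3 : (n : ℂ) + (ν : ℂ)⁻¹ ≠ 0 := by
        have : (0 : ℝ) < (n : ℝ) + ν⁻¹ := by positivity
        exact_mod_cast this.ne'
      have e4 : (1 + (μ : ℂ) * n) = μ * (n + (μ : ℂ)⁻¹) := by field_simp; ring
      have e5 : (1 + (ν : ℂ) * n) = ν * (n + (ν : ℂ)⁻¹) := by field_simp; ring
      simp only [hκ, hM, kernelCoeff, hn, if_false, sub_zero, add_zero, ← hA, e4, e5]
      rw [← hzn]
      push_cast
      set p := (n : ℂ) + (μ : ℂ)⁻¹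
      set r := (n : ℂ) + (ν : ℂ)⁻¹
      field_simp
      ring
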